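/- Let $r\ge 2$ be an even integer and let $\Sigma_{1,r}$ be the annulus with one marked point $p$ on its outer boundary circle and $r$ marked points $p_1,\dots,p_r$ (listed clockwise, $p_{n+r}=p_n$ for $n\in\mathbb Z$) on its inner boundary circle. Let $\mathcal A$ be the noncommutative algebra of $\Sigma_{1,r}$: the $\mathbb Q$-algebra generated by invertible elements $x_\gamma$, one for each homotopy class $\gamma$ of directed curves between marked points ($\overline\gamma$ denotes the reversed curve), subject to - $x_\gamma=1$ for trivial $\gamma$; - $x_{\gamma_1}x_{\overline\gamma_2}^{-1}x_{\gamma_3}=x_{\overline\gamma_3}x_{\gamma_2}^{-1}x_{\overline\gamma_1}$ for every triangle $(\gamma_1,\gamma_2,\gamma_3)$ in $\Sigma_{1,r}$; - $x_{\gamma_{24}}=x_{\gamma_{21}}x_{\gamma_{31}}^{-1}x_{\gamma_{34}}+x_{\gamma_{23}}x_{\gamma_{13}}^{-1}x_{\gamma_{14}}$ for every quadrilateral in $\Sigma_{1,r}$ with vertices $1,2,3,4$ in cyclic order and sides and diagonals $\gamma_{ij}$. For $n\in\mathbb Z$ let $x_n,\overline x_n\in\mathcal A$ correspond to the curve $\gamma_n$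 from $p$ to $p_n$ (with winding number $q$ if $n=rq+s$, $1\le s\le r$) and to its reverse; let $c_n,\overline c_n$ correspond to the short boundary arc from $p_{n-1}$ to $p_n$ and to its reverse, and $d,\overline d$ to the clockwise and counterclockwise outer boundary loops at $p$. Let $\mathbb T_r$ be the group with generators $x_n,\overline x_n$ ($1\le n\le r+1$), $c_i,\overline c_i$ ($i\in\mathbb Z/r$), $d,\overline d$ and relations $$\overline x_{r+1}\overline d^{\,-1}x_1=\overline x_1d^{-1}x_{r+1},\qquad x_{s-1}\overline c_s^{\,-1}\overline x_s=x_sc_s^{-1}\overline x_{s-1}\quad(2\le s\le r+1).$$ These relations hold in $\mathcal A$, so there is a canonical homomorphism $\mathbb Z\mathbb T_r\to\mathcal A$. Put $D:=d^{-1}$, $\overline D:=\overline d^{\,-1}$; for $n\in\mathbb Z$ put $C_n:=c_n$ if $n$ is even and $C_n:=\overline c_n$ if $n$ is odd (so $C_{n+r}=C_n$); for $1\le j\le r+1$ put $U_j:=x_j$ if $j$ is even and $U_j:=\overline x_j$ if $j$ is odd. Let $Frac(\mathbb Z\mathbb T_r)$ be the universal skew field of fractions of the free group algebra $\mathbb Q\mathbb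 T_r$, that is, its universal localization at all full matrices. Then: 1. The $2r+3$ elements $D,\overline D,C_1,\dots,C_r,U_1,\dots,U_{r+1}$ freely generate a free subgroup $F_{2r+3}$ of $\mathbb T_r$. 2. There is a unique extension of $U_1,\dots,U_{r+1}$ to a family $(U_n)_{n\in\mathbb Z}$ in $\mathbb Z\mathbb T_r$ such that, for all $n\in\mathbb Z$, $$\begin{cases}U_{n-r-1}\,D\,U_n=C_n+U_{n-1}\,\overline D\,U_{n-r}&\text{if $n$ is even},\\ U_n\,\overline D\,U_{n-r-1}=C_n+U_{n-r}\,D\,U_{n-1}&\text{if $n$ is odd}.\end{cases}$$ The image of $U_n$ in $\mathcal A$ is $x_n$ if $n$ is even and $\overline x_n$ if $n$ is odd, for every $n\in\mathbb Z$. 3. Each $U_n$ is a (finite, non-empty) sum of elements of the free group $F_{2r+3}$. 4. Each $U_n$ is invertible in $Frac(\mathbb Z\mathbb T_r)$, and the element $$H_n:=\begin{cases}\overline D\,U_{n-r}U_n^{-1}+D\,U_{n+r}U_n^{-1}&\text{if $n$ is even},\\ U_n^{-1}U_{n-r}D+U_n^{-1}U_{n+r}\overline D&\text{if $n$ is odd}\end{cases}$$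 of $Frac(\mathbb Z\mathbb T_r)$ does not depend on $n\in\mathbb Z$ and belongs to $\mathbb Z\mathbb T_r$, and in fact to $\mathbb ZF_{2r+3}$. -/

import Mathlib

noncomputable section

namespace NCAnnulus

/-! ## The marked annulus and its noncommutative algebra

The annulus has one marked point `p` on the outer circle and `r` marked points `p_1, …, p_r` on the
inner circle.  Its universal cover is a strip.  The lifts of `p` are `outer q`, `q ∈ ℤ`, and the
lifts of the inner marked points are `inner n`, `n ∈ ℤ`, where `inner n` lies over `p_s` with
`s ≡ n mod r`; both lines are numbered in the clockwise direction.  The homotopy class of a curve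
between marked points of the annulus is a pair of marked points of the strip (the end points of a
lift), up to deck transformations. -/

/-- Marked points of the universal cover (a strip) of the annulus. -/
inductive Vertex : Type
  | outer (q : ℤ) : Vertex
  | inner (n : ℤ) : Vertex

namespace Vertex

/-- The generator of the group of deck transformations. -/
def shift (r : ℕ) : Vertex → Vertex
  | outer q => outer (q + 1)
  | inner n => inner (n + r)

/-- The linear order of the marked points along the boundary of the strip: first the outer line in
one direction, then the inner line in the opposite direction. -/
def Before : Vertex → Vertex → Prop
  | outer q, outer q' => q < q'
  | outer _, inner _ => True
  | inner _, outer _ => False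
  | inner n, inner n' => n' < n

/-- `(a, b, c, d)` are the vertices of a quadrilateral in the strip, in cyclic order. -/
def IsQuad (a b c d : Vertex) : Prop :=
  (Before a b ∧ Before b c ∧ Before c d) ∨ (Before b c ∧ Before c d ∧ Before d a) ∨
    (Before c d ∧ Before d a ∧ Before a b) ∨ (Before d a ∧ Before a b ∧ Before b c)

end Vertex

/-- Generators `x_γ` and `x_γ⁻¹`, where `γ` is given by the end points of a lift. -/
inductive CurveGen : Type
  | x (a b : Vertex) : CurveGen
  | xinv (a b : Vertex) : CurveGen

/-- The generator `x_γ` in the free algebra. -/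
abbrev gx (a b : Vertex) : FreeAlgebra ℚ CurveGen := FreeAlgebra.ι ℚ (CurveGen.x a b)

/-- The generator `x_γ⁻¹` in the free algebra. -/
abbrev gy (a b : Vertex) : FreeAlgebra ℚ CurveGen := FreeAlgebra.ι ℚ (CurveGen.xinv a b)

/-- Defining relations of the algebra of the annulus. -/
inductive CurveRel (r : ℕ) : FreeAlgebra ℚ CurveGen → FreeAlgebra ℚ CurveGen → Prop
  | deck (a b : Vertex) : CurveRel r (gx (a.shift r) (b.shift r)) (gx a b)
  | trivial (a : Vertex) : CurveRel r (gx a a) 1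
  | mul_inv (a b : Vertex) : CurveRel r (gx a b * gy a b) 1
  | inv_mul (a b : Vertex) : CurveRel r (gy a b * gx a b) 1
  | triangle (a b c : Vertex) (hab : a ≠ b) (hbc : b ≠ c) (hca : c ≠ a) :
      CurveRel r (gx a b * gy c b * gx c a) (gx a c * gy b c * gx b a)
  | exchange (a b c d : Vertex) (h : Vertex.IsQuad a b c d) :
      CurveRel r (gx b d) (gx b a * gy c a * gx c d + gx b c * gy a c * gx a d)

/-- The noncommutative algebra of the annulus with `1` outer and `r` inner marked points. -/
abbrev AnnulusAlg (r : ℕ) : Type := RingQuot (CurveRel r)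

/-- The invertible element `x_γ`, where a lift of `γ` goes from `a` to `b`. -/
def curve (r : ℕ) (a b : Vertex) : (AnnulusAlg r)ˣ where
  val := RingQuot.mkAlgHom ℚ (CurveRel r) (gx a b)
  inv := RingQuot.mkAlgHom ℚ (CurveRel r) (gy a b)
  val_inv := by
    rw [← map_mul, RingQuot.mkAlgHom_rel ℚ (CurveRel.mul_inv a b), map_one]
  inv_val := by
    rw [← map_mul, RingQuot.mkAlgHom_rel ℚ (CurveRel.inv_mul a b), map_one]

theorem curve_deck (r : ℕ) (a b : Vertex) :
    curve r (a.shift r) (b.shift r) = curve r a b :=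
  Units.ext (RingQuot.mkAlgHom_rel ℚ (CurveRel.deck a b))

theorem curve_triangle (r : ℕ) (a b c : Vertex) (hab : a ≠ b) (hbc : b ≠ c) (hca : c ≠ a) :
    curve r a b * (curve r c b)⁻¹ * curve r c a =
      curve r a c * (curve r b c)⁻¹ * curve r b a := by
  have h := RingQuot.mkAlgHom_rel ℚ (CurveRel.triangle (r := r) a b c hab hbc hca)
  simp only [map_mul] at h
  exact Units.ext h

open Vertex in
/-- `x_n = x_{γ_n}`, where `γ_n` goes from `p` to `p_n` with the winding number determined by `n`. -/
def xCurve (r : ℕ) (n : ℤ) : (AnnulusAlg r)ˣ := curve r (outer 0) (inner n)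

open Vertex in
/-- `x̄_n`, for the curve opposite to `γ_n`. -/
def xbarCurve (r : ℕ) (n : ℤ) : (AnnulusAlg r)ˣ := curve r (inner n) (outer 0)

open Vertex in
/-- `c_n`, for the short boundary arc from `p_{n-1}` to `p_n` on the inner circle. -/
def cCurve (r : ℕ) (n : ℤ) : (AnnulusAlg r)ˣ := curve r (inner (n - 1)) (inner n)

open Vertex in
/-- `c̄_n`, for the short boundary arc from `p_n` to `p_{n-1}` on the inner circle. -/
def cbarCurve (r : ℕ) (n : ℤ) : (AnnulusAlg r)ˣ := curve r (inner n) (inner (n - 1))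

open Vertex in
/-- `d`, for the clockwise loop at `p` along the outer circle. -/
def dCurve (r : ℕ) : (AnnulusAlg r)ˣ := curve r (outer 0) (outer 1)

open Vertex in
/-- `d̄`, for the counterclockwise loop at `p` along the outer circle. -/
def dbarCurve (r : ℕ) : (AnnulusAlg r)ˣ := curve r (outer 1) (outer 0)

/-- `U_n`, as an element of the algebra of the annulus: `x_n` for even and `x̄_n` for odd `n`. -/
def uCurve (r : ℕ) (n : ℤ) : (AnnulusAlg r)ˣ :=
  if Even n then xCurve r n else xbarCurve r n

/-! ## The triangle group of the annulus -/

/-- Generators of the triangle group: `x i` and `xbar i` stand for `x_{i+1}` and `x̄_{i+1}`, and the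
generators `c_i`, `c̄_i` are indexed by residues modulo `r`. -/
inductive TGen (r : ℕ) : Type
  | x (i : Fin (r + 1)) : TGen r
  | xbar (i : Fin (r + 1)) : TGen r
  | c (i : ZMod r) : TGen r
  | cbar (i : ZMod r) : TGen r
  | d : TGen r
  | dbar : TGen r

open FreeGroup TGen in
/-- The triangle relations `x̄_{r+1} d̄⁻¹ x_1 = x̄_1 d⁻¹ x_{r+1}` and
`x_{s-1} c̄_s⁻¹ x̄_s = x_s c_s⁻¹ x̄_{s-1}` for `s = i + 2 = 2, …, r+1`. -/
def tRels (r : ℕ) : Set (FreeGroup (TGen r)) :=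
  {(of (xbar (Fin.last r)) * (of dbar)⁻¹ * of (x 0)) *
      (of (xbar 0) * (of d)⁻¹ * of (x (Fin.last r)))⁻¹} ∪
  Set.range fun i : Fin r =>
    (of (x i.castSucc) * (of (cbar ((i : ℕ) + 2 : ℕ)))⁻¹ * of (xbar i.succ)) *
      (of (x i.succ) * (of (c ((i : ℕ) + 2 : ℕ)))⁻¹ * of (xbar i.castSucc))⁻¹

/-- The triangle group `𝕋_r`. -/
abbrev TGroup (r : ℕ) : Type := PresentedGroup (tRels r)

/-- The curve in the annulus that corresponds to a generator of the triangle group. -/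
def tGenCurve (r : ℕ) : TGen r → (AnnulusAlg r)ˣ
  | .x i => xCurve r ((i : ℕ) + 1)
  | .xbar i => xbarCurve r ((i : ℕ) + 1)
  | .c i => cCurve r (i.cast : ℤ)
  | .cbar i => cbarCurve r (i.cast : ℤ)
  | .d => dCurve r
  | .dbar => dbarCurve r

theorem curve_inner_add_mul (r : ℕ) (m n : ℤ) (k : ℤ) :
    curve r (.inner (m + r * k)) (.inner (n + r * k)) = curve r (.inner m) (.inner n) := by
  have step : ∀ m n : ℤ, curve r (.inner (m + r)) (.inner (n + r)) =
      curve r (.inner m) (.inner n) := fun m n => curve_deck r (.inner m) (.inner n)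
  induction k with
  | zero => simp
  | succ k ih => rw [← ih, ← step (m + r * k)]; congr 2 <;> ring
  | pred k ih => rw [← ih, ← step]; congr 2 <;> ring

theorem cCurve_cast (r : ℕ) (n : ℤ) : cCurve r (((n : ZMod r)).cast : ℤ) = cCurve r n := by
  obtain ⟨k, hk⟩ := (ZMod.intCast_eq_intCast_iff_dvd_sub n (((n : ZMod r)).cast : ℤ) r).1 (by simp)
  have h : (((n : ZMod r)).cast : ℤ) = n + r * k := by omega
  rw [h, cCurve, cCurve, ← curve_inner_add_mul r (n - 1) n k]
  congr 2; ring

theorem cbarCurve_cast (r : ℕ) (n : ℤ) :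
    cbarCurve r (((n : ZMod r)).cast : ℤ) = cbarCurve r n := by
  obtain ⟨k, hk⟩ := (ZMod.intCast_eq_intCast_iff_dvd_sub n (((n : ZMod r)).cast : ℤ) r).1 (by simp)
  have h : (((n : ZMod r)).cast : ℤ) = n + r * k := by omega
  rw [h, cbarCurve, cbarCurve, ← curve_inner_add_mul r n (n - 1) k]
  congr 2; ring

theorem tGenCurve_rels (r : ℕ) :
    ∀ w ∈ tRels r, FreeGroup.lift (tGenCurve r) w = 1 := by
  rintro w (rfl | ⟨i, rfl⟩)
  · simp only [map_mul, map_inv, FreeGroup.lift_apply_of, mul_inv_eq_one, tGenCurve, xCurve,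
      xbarCurve, dCurve, dbarCurve, Fin.val_last, Fin.val_zero]
    have h1 : curve r (.outer 0) (.inner (((0 : ℕ) : ℤ) + 1)) =
        curve r (.outer 1) (.inner ((r : ℤ) + 1)) := by
      rw [← curve_deck]; simp [Vertex.shift, add_comm]
    have h2 : curve r (.inner (((0 : ℕ) : ℤ) + 1)) (.outer 0) =
        curve r (.inner ((r : ℤ) + 1)) (.outer 1) := by
      rw [← curve_deck]; simp [Vertex.shift, add_comm]
    rw [h1, h2]
    exact curve_triangle r (.inner ((r : ℤ) + 1)) (.outer 0) (.outer 1) (by simp) (by simp)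
      (by simp)
  · have hc := cCurve_cast r (((i : ℕ) + 2 : ℕ) : ℤ)
    have hcb := cbarCurve_cast r (((i : ℕ) + 2 : ℕ) : ℤ)
    rw [Int.cast_natCast] at hc hcb
    simp only [map_mul, map_inv, FreeGroup.lift_apply_of, mul_inv_eq_one, tGenCurve, hc, hcb]
    simp only [xCurve, xbarCurve, cCurve, cbarCurve, Fin.val_castSucc, Fin.val_succ]
    have e1 : (((i : ℕ) + 2 : ℕ) : ℤ) = ((i : ℕ) : ℤ) + 1 + 1 := by push_cast; ring
    have e2 : (((i : ℕ) + 1 : ℕ) : ℤ) = ((i : ℕ) : ℤ) + 1 := by push_cast; ring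
    rw [e1, e2, add_sub_cancel_right]
    exact curve_triangle r (.outer 0) (.inner (((i : ℕ) : ℤ) + 1))
      (.inner (((i : ℕ) : ℤ) + 1 + 1)) (by simp) (by simp) (by simp)

/-- The group algebra `ℤ 𝕋_r`. -/
abbrev ZT (r : ℕ) : Type := MonoidAlgebra ℤ (TGroup r)

/-- The canonical homomorphism from `ℤ 𝕋_r` to the algebra of the annulus, which sends each
generator of `𝕋_r` to the corresponding curve. -/
def toAnnulusAlg (r : ℕ) : ZT r →+* AnnulusAlg r :=
  (MonoidAlgebra.lift ℤ (AnnulusAlg r) (TGroup r)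
    ((Units.coeHom (AnnulusAlg r)).comp (PresentedGroup.toGroup (tGenCurve_rels r)))).toRingHom

/-! ## The elements `D`, `D̄`, `C_n`, `U_1, …, U_{r+1}` of the triangle group -/

/-- `D = d⁻¹`. -/
def tD (r : ℕ) : TGroup r := (PresentedGroup.of TGen.d)⁻¹

/-- `D̄ = d̄⁻¹`. -/
def tDbar (r : ℕ) : TGroup r := (PresentedGroup.of TGen.dbar)⁻¹

/-- `C_n` is `c_n` for even `n` and `c̄_n` for odd `n`, with indices of `c`, `c̄` modulo `r`. -/
def tC (r : ℕ) (n : ℤ) : TGroup r :=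
  if Even n then PresentedGroup.of (TGen.c n) else PresentedGroup.of (TGen.cbar n)

/-- `U_{j+1}`, for `j = 0, …, r`: it is `x_{j+1}` if `j + 1` is even and `x̄_{j+1}` if it is odd. -/
def tU (r : ℕ) (j : Fin (r + 1)) : TGroup r :=
  if Even ((j : ℕ) + 1) then PresentedGroup.of (TGen.x j) else PresentedGroup.of (TGen.xbar j)

/-- An alphabet of `2r + 3` letters: `D`, `D̄`, `C_1, …, C_r`, `U_1, …, U_{r+1}`. -/
inductive Letter (r : ℕ) : Type
  | D : Letter r
  | Dbar : Letter r
  | C (i : Fin r) : Letter r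
  | U (j : Fin (r + 1)) : Letter r

/-- The element of the triangle group denoted by a letter. -/
def Letter.toT (r : ℕ) : Letter r → TGroup r
  | .D => tD r
  | .Dbar => tDbar r
  | .C i => tC r ((i : ℕ) + 1)
  | .U j => tU r j

/-- The homomorphism from the free group on the letters to the triangle group. -/
def freeToT (r : ℕ) : FreeGroup (Letter r) →* TGroup r := FreeGroup.lift (Letter.toT r)

/-- A group element as an element of the group algebra. -/
abbrev el {r : ℕ} (g : TGroup r) : ZT r := MonoidAlgebra.of ℤ (TGroup r) g

/-- The homomorphism from the group algebra of the free group on the letters to `ℤ 𝕋_r`. -/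
def freeAlgToZT (r : ℕ) : MonoidAlgebra ℤ (FreeGroup (Letter r)) →+* ZT r :=
  MonoidAlgebra.mapDomainRingHom ℤ (freeToT r)

/-- `U` starts with the group elements `U_1, …, U_{r+1}` and satisfies the recursion. -/
structure IsSolution (r : ℕ) (U : ℤ → ZT r) : Prop where
  initial : ∀ j : Fin (r + 1), U ((j : ℕ) + 1) = el (tU r j)
  even : ∀ n : ℤ, Even n →
    U (n - r - 1) * el (tD r) * U n = el (tC r n) + U (n - 1) * el (tDbar r) * U (n - r)
  odd : ∀ n : ℤ, Odd n →
    U n * el (tDbar r) * U (n - r - 1) = el (tC r n) + U (n - r) * el (tD r) * U (n - 1)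

/-! ## The universal localization at full matrices -/

/-- A square matrix over `R` is full if it is not a product of an `n × p` and a `p × n` matrix with
`p < n`. -/
def IsFull {R : Type*} [Ring R] {n : ℕ} (A : Matrix (Fin n) (Fin n) R) : Prop :=
  ∀ (p : ℕ) (B : Matrix (Fin n) (Fin p) R) (C : Matrix (Fin p) (Fin n) R), A = B * C → n ≤ p

/-- Generators of the universal localization: the elements of `R`, and the entries of a formal
inverse of each full matrix. -/
inductive FracGen (R : Type*) [Ring R] : Type _
  | coe (a : R) : FracGen R
  | inv (n : ℕ) (A : Matrix (Fin n) (Fin n) R) (h : IsFull A) (i j : Fin n) : FracGen R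

section FracDefs

variable (R : Type*) [Ring R]

open FreeAlgebra FracGen in
/-- Defining relations of the universal localization. -/
inductive FracRel : FreeAlgebra ℤ (FracGen R) → FreeAlgebra ℤ (FracGen R) → Prop
  | one : FracRel (ι ℤ (coe 1)) 1
  | mul (a b : R) : FracRel (ι ℤ (coe (a * b))) (ι ℤ (coe a) * ι ℤ (coe b))
  | add (a b : R) : FracRel (ι ℤ (coe (a + b))) (ι ℤ (coe a) + ι ℤ (coe b))
  | mul_inv (n : ℕ) (A : Matrix (Fin n) (Fin n) R) (h : IsFull A) (i j : Fin n) :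
      FracRel (∑ k, ι ℤ (coe (A i k)) * ι ℤ (inv n A h k j)) (if i = j then 1 else 0)
  | inv_mul (n : ℕ) (A : Matrix (Fin n) (Fin n) R) (h : IsFull A) (i j : Fin n) :
      FracRel (∑ k, ι ℤ (inv n A h i k) * ι ℤ (coe (A k j))) (if i = j then 1 else 0)

/-- `Frac R`: the universal localization of `R` at all full matrices.  If `R` is a semifir, for
example the group algebra of a free group over a field, this is the universal skew field of
fractions of `R`. -/
abbrev Frac : Type _ := RingQuot (FracRel R)

/-- The canonical homomorphism to the universal localization. -/
def toFrac : R →+* Frac R :=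
  RingHom.mk'
    { toFun := fun a => RingQuot.mkRingHom (FracRel R) (FreeAlgebra.ι ℤ (FracGen.coe a))
      map_one' := by rw [RingQuot.mkRingHom_rel FracRel.one, map_one]
      map_mul' := fun a b => by rw [RingQuot.mkRingHom_rel (FracRel.mul a b), map_mul] }
    fun a b => by
      change RingQuot.mkRingHom (FracRel R) _ = _
      rw [RingQuot.mkRingHom_rel (FracRel.add a b), map_add]; rfl

end FracDefs

/-- The skew field of fractions of the group algebra of the triangle group. -/
abbrev FracT (r : ℕ) : Type := Frac (MonoidAlgebra ℚ (TGroup r))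

/-- The canonical homomorphism from `ℤ 𝕋_r` to the skew field of fractions. -/
def toFracT (r : ℕ) : ZT r →+* FracT r :=
  (toFrac (MonoidAlgebra ℚ (TGroup r))).comp
    (MonoidAlgebra.mapRingHom (TGroup r) (Int.castRingHom ℚ))

open Ring in
/-- The quantity `H_n` of a sequence `U`, in the skew field of fractions. -/
def hQuantity (r : ℕ) (U : ℤ → ZT r) (n : ℤ) : FracT r :=
  if Even n then
    toFracT r (el (tDbar r)) * toFracT r (U (n - r)) * inverse (toFracT r (U n)) +
      toFracT r (el (tD r)) * toFracT r (U (n + r)) * inverse (toFracT r (U n))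
  else
    inverse (toFracT r (U n)) * toFracT r (U (n - r)) * toFracT r (el (tD r)) +
      inverse (toFracT r (U n)) * toFracT r (U (n + r)) * toFracT r (el (tDbar r))

end NCAnnulus

end

/-! The nonlinear recursion linearizes. Let `H` be the total noncommutative angle at the outer
marked point: the sum of the angles between consecutive `U_{n-1}`, `U_n` and of the two corners at
`p` of the triangle bounded by the outer loop. Along each residue class mod `r`, the recurrence `D̄
U_{n-r} + D U_{n+r} = H U_n` (`n` even), or its mirror image (`n` odd), together with suitable
initial values, defines a two-sided sequence, because `D` and `D̄` are invertible. For these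
sequences the defect of the exchange relation is `r`-periodic, since `H` cancels between adjacent
indices of opposite parity, and over one period it equals `C_n` (`exists_exchange_sequence`). The
formula for `H_n` is then the linear recurrence divided by `U_n`.

Positivity comes from cutting the total angle at `U_m`: `H = a + b`, where `a D⁻¹ b - D̄` and `b
D̄⁻¹ a - D` have nonnegative coefficients. This factorization removes the subtraction from the
recurrence (`exists_pos_linearRecurrence`). Everything is computed in the group ring of the free
group on the `2r + 3` letters and then mapped to `ℤ 𝕋_r`.

Solving the triangle relations embeds `𝕋_r` into the free group on the letters and `r` opposites of
the `U_j` (`tToFree_injective`). So the letters are free and `𝕋_r` has unique products, hence `ℤ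
𝕋_r` has no zero divisors. With nonzero `U_n` the recursion can be solved uniquely in both
directions (`exchange_unique`). The same lemma identifies the image in the annulus algebra, where
the curves satisfy the recursion and are units. A positive sum is nonzero, hence a full `1 × 1`
matrix, hence invertible in the localization. -/

/-! ### Unique products in free groups -/

open Finset in
/-- A group all of whose nontrivial subgroups map nontrivially to `ℤ` has unique products. -/
theorem UniqueProds.of_forall_subgroup {G : Type*} [Group G]
    (h : ∀ K : Subgroup G, K ≠ ⊥ → ∃ f : K →* Multiplicative ℤ, f ≠ 1) : UniqueProds G where
  uniqueMul_of_nonempty := by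
    classical
    intro A B
    induction hn : #A + #B using Nat.strong_induction_on generalizing A B with
    | _ n ih =>
      subst hn
      rintro ⟨a, ha⟩ ⟨b, hb⟩
      -- Both sets are translated so as to contain `1`; a homomorphism to `ℤ` that is nontrivial on
      -- the subgroup they generate is then nonconstant on at least one of them.
      let S : Set G := (fun x => a⁻¹ * x) '' A ∪ (fun y => y * b⁻¹) '' B
      by_cases hK : Subgroup.closure S = ⊥
      · rw [Subgroup.closure_eq_bot_iff] at hK
        refine ⟨a, ha, b, hb, fun x y hx hy _ => ⟨?_, ?_⟩⟩
        · exact (inv_mul_eq_one.1 (hK (Or.inl ⟨x, hx, rfl⟩))).symm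
        · exact mul_inv_eq_one.1 (hK (Or.inr ⟨y, hy, rfl⟩))
      · obtain ⟨f, hf⟩ := h _ hK
        let g : G → ℤ := fun x =>
          if hx : x ∈ Subgroup.closure S then (f ⟨x, hx⟩).toAdd else 0
        have hg : ∀ {x y : G}, x ∈ S → y ∈ S → g (x * y) = g x + g y := by
          intro x y hx hy
          have hx' : x ∈ Subgroup.closure S := Subgroup.subset_closure hx
          have hy' : y ∈ Subgroup.closure S := Subgroup.subset_closure hy
          simp only [g, dif_pos hx', dif_pos hy', dif_pos (mul_mem hx' hy')]
          rw [← toAdd_mul, ← map_mul]; rfl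
        have hg1 : g 1 = 0 := by
          simp only [g, dif_pos (one_mem _)]
          exact congrArg Multiplicative.toAdd (map_one f)
        have hS : ∃ s ∈ S, g s ≠ 0 := by
          by_contra! hc
          refine hf (MonoidHom.eq_of_eqOn_dense
            (s := (Subtype.val : Subgroup.closure S → G) ⁻¹' S) ?_ ?_)
          · exact Subgroup.closure_closure_coe_preimage
          · rintro ⟨x, hx⟩ hxS
            have := hc x hxS
            simp only [g, dif_pos hx] at this
            exact this
        let α : G → ℤ := fun x => g (a⁻¹ * x)
        let β : G → ℤ := fun y => g (y * b⁻¹)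
        have hα : α a = 0 := by simp [α, hg1]
        have hβ : β b = 0 := by simp [β, hg1]
        have hαβ : ∀ x ∈ A, ∀ y ∈ B, α x + β y = g (a⁻¹ * (x * y) * b⁻¹) := fun x hx y hy => by
          rw [← hg (Or.inl ⟨x, hx, rfl⟩) (Or.inr ⟨y, hy, rfl⟩)]; simp only [mul_assoc]
        obtain ⟨x₀, hx₀, hxm⟩ := exists_max_image A α ⟨a, ha⟩
        obtain ⟨y₀, hy₀, hym⟩ := exists_max_image B β ⟨b, hb⟩
        -- Since `α a = β b = 0` and `g` is nonzero somewhere on `S`, one of the two maximal level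
        -- sets is proper. A unique product of the level sets is unique in `A * B`, because `α + β`
        -- depends only on the product.
        have hlt : #(A.filter (α · = α x₀)) + #(B.filter (β · = β y₀)) < #A + #B := by
          have h1 := card_filter_le A (α · = α x₀)
          have h2 := card_filter_le B (β · = β y₀)
          obtain ⟨s, ⟨x, hx, rfl⟩ | ⟨y, hy, rfl⟩, hs⟩ := hS
          · have : #(A.filter (α · = α x₀)) < #A := by
              refine card_lt_card (filter_ssubset.2 ?_)
              by_contra! hc
              exact hs ((hc x hx).trans ((hc a ha).symm.trans hα))
            omega
          · have : #(B.filter (β · = β y₀)) < #B := by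
              refine card_lt_card (filter_ssubset.2 ?_)
              by_contra! hc
              exact hs ((hc y hy).trans ((hc b hb).symm.trans hβ))
            omega
        obtain ⟨a₀, ha₀, b₀, hb₀, hu⟩ := ih _ hlt rfl ⟨x₀, by simp [hx₀]⟩ ⟨y₀, by simp [hy₀]⟩
        rw [mem_filter] at ha₀ hb₀
        refine ⟨a₀, ha₀.1, b₀, hb₀.1, fun x y hx hy hxy => ?_⟩
        have e1 := hαβ x hx y hy
        have e2 := hαβ a₀ ha₀.1 b₀ hb₀.1
        rw [hxy, ← e2, ha₀.2, hb₀.2] at e1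
        have := hxm x hx
        have := hym y hy
        exact hu (mem_filter.2 ⟨hx, by omega⟩) (mem_filter.2 ⟨hy, by omega⟩) hxy

/-- By Nielsen–Schreier every subgroup is free; a free group with at least one generator maps onto
`ℤ`, and one without generators is trivial. -/
instance FreeGroup.instUniqueProds (α : Type*) : UniqueProds (FreeGroup α) := by
  classical
  refine UniqueProds.of_forall_subgroup fun K hK => ?_
  by_contra! hc
  refine hK ((Subgroup.eq_bot_iff_forall _).2 fun x hx => ?_)
  have hgen : IsEmpty (IsFreeGroup.Generators K) := ⟨fun i => by
    have h1 := IsFreeGroup.lift_of (fun _ : IsFreeGroup.Generators K => Multiplicative.ofAdd (1 : ℤ)) i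
    rw [hc (IsFreeGroup.lift _)] at h1
    exact zero_ne_one (α := ℤ) (congrArg Multiplicative.toAdd h1)⟩
  have : (⟨x, hx⟩ : K) = 1 := by
    apply (IsFreeGroup.toFreeGroup K).injective
    exact Subsingleton.elim _ _
  exact congrArg Subtype.val this

/-! ### Positivity of second order linear recurrences -/

section Recurrence

variable {A : Type*} [Ring A]

/-- A two-sided second order linear recurrence over a ring has a solution with given initial
values. -/
theorem exists_int_linearRecurrence {D D' E E' : A} (hD : D * D' = 1) (hD' : D' * D = 1)
    (hE : E * E' = 1) (hE' : E' * E = 1) (H v w : A) :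
    ∃ W : ℤ → A, W 0 = v ∧ W 1 = w ∧ ∀ k, E * W (k - 1) + D * W (k + 1) = H * W k := by
  -- The companion map `(W k, W (k + 1)) ↦ (W (k + 1), W (k + 2))`; its integer powers give the
  -- two-sided sequence.
  let σ : Equiv.Perm (A × A) :=
    { toFun := fun p => (p.2, D' * (H * p.2 - E * p.1))
      invFun := fun p => (E' * (H * p.1 - D * p.2), p.1)
      left_inv := fun p => by
        ext
        · simp [← mul_assoc, hD, hE']
        · rfl
      right_inv := fun p => by
        ext
        · rfl
        · simp [← mul_assoc, hE, hD'] }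
  have hsucc : ∀ k : ℤ, (σ ^ (k + 1)) (v, w) = σ ((σ ^ k) (v, w)) := fun k => by
    rw [add_comm, zpow_add, zpow_one, Equiv.Perm.mul_apply]
  refine ⟨fun k => ((σ ^ k) (v, w)).1, rfl, rfl, fun k => ?_⟩
  obtain ⟨j, rfl⟩ : ∃ j, k = j + 1 := ⟨k - 1, by ring⟩
  simp only [add_sub_cancel_right, hsucc]
  simp [σ, ← mul_assoc, hD]

variable (S : Subsemiring A) (ε : A →+* ℤ)

/-- Positivity of a sequence with a second order linear recurrence whose characteristic equation
has a positive splitting. -/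
theorem pos_of_linearRecurrence_nat (hS : ∀ x ∈ S, 0 ≤ ε x) {D D' E a b p : A}
    (hD' : D' * D = 1) (hDS : D' ∈ S) (ha : a ∈ S) (hb : b ∈ S) (hbε : 0 < ε b) (hp : p ∈ S)
    (hab : a * D' * b = E + p) {W : ℕ → A} (h0 : W 0 ∈ S) (h0ε : 0 < ε (W 0))
    (h1 : D * W 1 = b * W 0) (hW : ∀ k, E * W k + D * W (k + 2) = (a + b) * W (k + 1)) (k : ℕ) :
    W k ∈ S ∧ 0 < ε (W k) := by
  have hDε : 0 < ε D' := by
    refine lt_of_le_of_ne (hS _ hDS) fun h => ?_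
    have := congrArg ε hD'
    simp [← h] at this
  have step : ∀ k, W k ∈ S → 0 < ε (W k) → ∀ z ∈ S, D * W (k + 1) = z + b * W k →
      W (k + 1) ∈ S ∧ 0 < ε (W (k + 1)) := fun k hk hkε z hz h => by
    have e : W (k + 1) = D' * (z + b * W k) := by rw [← h, ← mul_assoc, hD', one_mul]
    refine ⟨e ▸ S.mul_mem hDS (S.add_mem hz (S.mul_mem hb hk)), ?_⟩
    rw [e, map_mul, map_add, map_mul]
    have := hS z hz
    positivity
  -- The induction carries the remainder `z = D W_{k+1} - b W_k`. The splitting turns the recurrence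
  -- into `z_{k+1} = a D' z_k + p W_k`, in which no minus sign is left.
  suffices h : (W k ∈ S ∧ 0 < ε (W k)) ∧ ∃ z ∈ S, D * W (k + 1) = z + b * W k from h.1
  induction k with
  | zero => exact ⟨⟨h0, h0ε⟩, 0, S.zero_mem, by rw [zero_add, zero_add, h1]⟩
  | succ k ih =>
    obtain ⟨⟨hk, hkε⟩, z, hz, h⟩ := ih
    refine ⟨step k hk hkε z hz h, a * D' * z + p * W k, S.add_mem
      (S.mul_mem (S.mul_mem ha hDS) hz) (S.mul_mem hp hk), ?_⟩
    have e : W (k + 1) = D' * (z + b * W k) := by rw [← h, ← mul_assoc, hD', one_mul]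
    have e2 : a * W (k + 1) = a * D' * z + (E + p) * W k := by
      rw [e, ← hab]; noncomm_ring
    linear_combination (norm := noncomm_ring) hW k + e2

/-- The initial condition `D W_1 = b w` is equivalent to `E W_{-1} = a w`, so the negative half is
the positive half with `(D, b, p)` and `(E, a, q)` exchanged. -/
theorem exists_pos_linearRecurrence (hS : ∀ x ∈ S, 0 ≤ ε x) {D D' E E' a b p q w : A}
    (hD : D * D' = 1) (hD' : D' * D = 1) (hE : E * E' = 1) (hE' : E' * E = 1)
    (hDS : D' ∈ S) (hES : E' ∈ S) (ha : a ∈ S) (haε : 0 < ε a) (hb : b ∈ S) (hbε : 0 < ε b)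
    (hp : p ∈ S) (hq : q ∈ S) (hab : a * D' * b = E + p) (hba : b * E' * a = D + q)
    (hw : w ∈ S) (hwε : 0 < ε w) :
    ∃ W : ℤ → A, W 0 = w ∧ D * W 1 = b * w ∧
      (∀ k, E * W (k - 1) + D * W (k + 1) = (a + b) * W k) ∧ ∀ k, W k ∈ S ∧ 0 < ε (W k) := by
  obtain ⟨W, h0, h1, hW⟩ := exists_int_linearRecurrence hD hD' hE hE' (a + b) w (D' * (b * w))
  have h1' : D * W 1 = b * w := by rw [h1, ← mul_assoc, hD, one_mul]
  have hm : E * W (-1) = a * w := by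
    have := hW 0
    simp only [zero_sub, zero_add, h0, h1'] at this
    linear_combination (norm := noncomm_ring) this
  refine ⟨W, h0, h1', hW, fun k => ?_⟩
  obtain ⟨n, rfl | rfl⟩ := k.eq_nat_or_neg
  · refine pos_of_linearRecurrence_nat S ε hS hD' hDS ha hb hbε hp hab (W := fun n : ℕ => W n)
      ?_ ?_ ?_ (fun k => ?_) n
    · simpa [h0] using hw
    · simpa [h0] using hwε
    · simpa [h0] using h1'
    · have := hW (k + 1)
      rw [add_sub_cancel_right, add_assoc, one_add_one_eq_two] at this
      exact_mod_cast this
  · refine pos_of_linearRecurrence_nat S ε hS hE' hES hb ha haε hq hba (W := fun n : ℕ => W (-n))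
      ?_ ?_ ?_ (fun k => ?_) n
    · simpa [h0] using hw
    · simpa [h0] using hwε
    · simpa [h0] using hm
    · have := hW (-(k + 1))
      rw [show -((k : ℤ) + 1) - 1 = -((k + 2 : ℕ) : ℤ) by push_cast; ring,
        show -((k : ℤ) + 1) + 1 = -(k : ℤ) by ring] at this
      push_cast at this ⊢
      rw [add_comm, this, add_comm b]

/-- This is the left-handed version in the opposite ring. Reversing products swaps the two splitting
identities, hence the exchange of `D` with `E` and of `p` with `q`. -/
theorem exists_pos_linearRecurrence_right (hS : ∀ x ∈ S, 0 ≤ ε x) {D D' E E' a b p q w : A}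
    (hD : D * D' = 1) (hD' : D' * D = 1) (hE : E * E' = 1) (hE' : E' * E = 1)
    (hDS : D' ∈ S) (hES : E' ∈ S) (ha : a ∈ S) (haε : 0 < ε a) (hb : b ∈ S) (hbε : 0 < ε b)
    (hp : p ∈ S) (hq : q ∈ S) (hab : a * D' * b = E + p) (hba : b * E' * a = D + q)
    (hw : w ∈ S) (hwε : 0 < ε w) :
    ∃ W : ℤ → A, W 0 = w ∧ W 1 * E = w * b ∧
      (∀ k, W (k - 1) * D + W (k + 1) * E = W k * (a + b)) ∧ ∀ k, W k ∈ S ∧ 0 < ε (W k) := by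
  open MulOpposite in
  obtain ⟨W, h0, h1, hW, hpos⟩ := exists_pos_linearRecurrence S.op
    (ε.fromOpposite fun _ _ => mul_comm _ _) (fun x hx => hS _ hx)
    (D := op E) (D' := op E') (E := op D) (E' := op D') (a := op a) (b := op b) (p := op q)
    (q := op p) (w := op w) (by rw [← op_mul, hE', op_one]) (by rw [← op_mul, hE, op_one])
    (by rw [← op_mul, hD', op_one]) (by rw [← op_mul, hD, op_one]) hES hDS ha haε hb hbε hq hp
    (by rw [← op_mul, ← op_mul, ← mul_assoc, hba, op_add])
    (by rw [← op_mul, ← op_mul, ← mul_assoc, hab, op_add]) hw hwε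
  refine ⟨fun k => (W k).unop, congrArg MulOpposite.unop h0, congrArg MulOpposite.unop h1,
    fun k => congrArg MulOpposite.unop (hW k), hpos⟩

end Recurrence

/-! ### Nonnegative elements of the integral group ring -/

section Positive

variable (G : Type*) [Group G]

/-- The elements of the integral group ring with nonnegative coefficients. -/
noncomputable def MonoidAlgebra.nonnegSubsemiring : Subsemiring (MonoidAlgebra ℤ G) :=
  (MonoidHom.mrange (MonoidAlgebra.of ℤ G)).subsemiringClosure

/-- The augmentation of the integral group ring. -/
noncomputable def MonoidAlgebra.augmentation : MonoidAlgebra ℤ G →+* ℤ :=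
  (MonoidAlgebra.lift ℤ ℤ G 1).toRingHom

variable {G}

theorem MonoidAlgebra.augmentation_of (g : G) :
    augmentation G (of ℤ G g) = 1 := by
  simp [augmentation]

theorem MonoidAlgebra.of_mem_nonnegSubsemiring (g : G) :
    of ℤ G g ∈ nonnegSubsemiring G :=
  (Submonoid.subsemiringClosure_mem _).2 (AddSubmonoid.subset_closure ⟨g, rfl⟩)

/-- Separates the empty sum from the non-empty ones; positivity of the augmentation later excludes
the empty sum. -/
theorem MonoidAlgebra.eq_zero_or_mem_closure {x : MonoidAlgebra ℤ G}
    (hx : x ∈ nonnegSubsemiring G) :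
    x = 0 ∨ x ∈ AddSubsemigroup.closure (Set.range (of ℤ G)) := by
  replace hx := (Submonoid.subsemiringClosure_mem _).1 hx
  induction hx using AddSubmonoid.closure_induction with
  | mem x hx => exact Or.inr (AddSubsemigroup.subset_closure hx)
  | zero => exact Or.inl rfl
  | add x y _ _ hx hy =>
    rcases hx with rfl | hx
    · simpa using hy
    · rcases hy with rfl | hy
      · simpa using Or.inr hx
      · exact Or.inr (add_mem hx hy)

theorem MonoidAlgebra.augmentation_nonneg {x : MonoidAlgebra ℤ G}
    (hx : x ∈ nonnegSubsemiring G) : 0 ≤ augmentation G x := by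
  replace hx := (Submonoid.subsemiringClosure_mem _).1 hx
  induction hx using AddSubmonoid.closure_induction with
  | mem x hx => obtain ⟨g, rfl⟩ := hx; rw [augmentation_of]; exact zero_le_one
  | zero => simp
  | add x y _ _ hx hy => rw [map_add]; exact add_nonneg hx hy

end Positive

/-! ### Noncommutative angles and the sequence in a group ring -/

namespace NCAnnulus

section GroupRing

open MonoidAlgebra

variable {G : Type*} [Group G] (d e : G) (c u : ℤ → G) (r : ℕ)

/-- The angle between `U_{n-1}` and `U_n`. -/
def angle (n : ℤ) : G :=
  if Even n then (u (n - 1))⁻¹ * c n * (u n)⁻¹ else (u n)⁻¹ * c n * (u (n - 1))⁻¹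

/-- The first part of the total angle, up to `U_m`. -/
noncomputable def angleLeft (m : ℤ) : MonoidAlgebra ℤ G :=
  of ℤ G ((u 1)⁻¹ * u (r + 1) * e) + ∑ k ∈ Finset.Ioc 1 m, of ℤ G (angle c u k)

/-- The second part of the total angle, from `U_m` on. -/
noncomputable def angleRight (m : ℤ) : MonoidAlgebra ℤ G :=
  of ℤ G ((u (r + 1))⁻¹ * u 1 * d) + ∑ k ∈ Finset.Ioc m (r + 1), of ℤ G (angle c u k)

/-- The total angle at the outer marked point. -/
noncomputable def angleTotal : MonoidAlgebra ℤ G :=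
  angleLeft e c u r (r + 1) + of ℤ G ((u (r + 1))⁻¹ * u 1 * d)

theorem angleRight_add_angleLeft {m : ℤ} (h1 : 1 ≤ m) (h2 : m ≤ r + 1) :
    angleRight d c u r m + angleLeft e c u r m = angleTotal d e c u r := by
  have h : ∑ k ∈ Finset.Ioc 1 ((r : ℤ) + 1), of ℤ G (angle c u k) =
      ∑ k ∈ Finset.Ioc 1 m, of ℤ G (angle c u k) +
        ∑ k ∈ Finset.Ioc m (r + 1), of ℤ G (angle c u k) := by
    rw [← Finset.Ioc_union_Ioc_eq_Ioc h1 h2, Finset.sum_union (Finset.Ioc_disjoint_Ioc_of_le le_rfl)]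
  rw [angleTotal, angleRight, angleLeft, angleLeft, h]
  abel

theorem angleLeft_sub_one {m : ℤ} (h : 1 < m) :
    angleLeft e c u r m = angleLeft e c u r (m - 1) + of ℤ G (angle c u m) := by
  have : Finset.Ioc 1 m = insert m (Finset.Ioc 1 (m - 1)) := by ext; simp; omega
  rw [angleLeft, angleLeft, this, Finset.sum_insert (by simp)]
  abel

theorem sum_of_mem_nonnegSubsemiring (s : Finset ℤ) (f : ℤ → G) :
    ∑ k ∈ s, of ℤ G (f k) ∈ nonnegSubsemiring G :=
  sum_mem fun _ _ => of_mem_nonnegSubsemiring _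

theorem angleLeft_mem (m : ℤ) : angleLeft e c u r m ∈ nonnegSubsemiring G :=
  add_mem (of_mem_nonnegSubsemiring _) (sum_of_mem_nonnegSubsemiring _ _)

theorem angleRight_mem (m : ℤ) : angleRight d c u r m ∈ nonnegSubsemiring G :=
  add_mem (of_mem_nonnegSubsemiring _) (sum_of_mem_nonnegSubsemiring _ _)

theorem augmentation_angleLeft_pos (m : ℤ) : 0 < augmentation G (angleLeft e c u r m) := by
  rw [angleLeft, map_add, augmentation_of]
  have := augmentation_nonneg (sum_of_mem_nonnegSubsemiring (Finset.Ioc 1 m) (angle c u))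
  positivity

theorem augmentation_angleRight_pos (m : ℤ) : 0 < augmentation G (angleRight d c u r m) := by
  rw [angleRight, map_add, augmentation_of]
  have := augmentation_nonneg (sum_of_mem_nonnegSubsemiring (Finset.Ioc m (r + 1)) (angle c u))
  positivity

/-- The corner terms multiply to `(u_{r+1}⁻¹ u_1 d) d⁻¹ (u_1⁻¹ u_{r+1} e) = e`; the other products
in the expansion are group elements with coefficient one and form `p`. -/
theorem exists_angleRight_mul_angleLeft (m : ℤ) : ∃ p ∈ nonnegSubsemiring G,
    angleRight d c u r m * of ℤ G d⁻¹ * angleLeft e c u r m = of ℤ G e + p := by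
  have hA := sum_of_mem_nonnegSubsemiring (Finset.Ioc m (r + 1)) (angle c u)
  have hB := sum_of_mem_nonnegSubsemiring (Finset.Ioc 1 m) (angle c u)
  rw [angleLeft, angleRight]
  refine ⟨_, add_mem (mul_mem (mul_mem (of_mem_nonnegSubsemiring ((u (r + 1))⁻¹ * u 1 * d))
    (of_mem_nonnegSubsemiring d⁻¹)) hB) (mul_mem (mul_mem hA (of_mem_nonnegSubsemiring d⁻¹))
    (add_mem (of_mem_nonnegSubsemiring ((u 1)⁻¹ * u (r + 1) * e)) hB)), ?_⟩
  have key : of ℤ G ((u (r + 1))⁻¹ * u 1 * d) * of ℤ G d⁻¹ * of ℤ G ((u 1)⁻¹ * u (r + 1) * e) =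
      of ℤ G e := by rw [← map_mul, ← map_mul]; congr 1; group
  rw [← key]
  noncomm_ring

theorem exists_angleLeft_mul_angleRight (m : ℤ) : ∃ q ∈ nonnegSubsemiring G,
    angleLeft e c u r m * of ℤ G e⁻¹ * angleRight d c u r m = of ℤ G d + q := by
  have hA := sum_of_mem_nonnegSubsemiring (Finset.Ioc m (r + 1)) (angle c u)
  have hB := sum_of_mem_nonnegSubsemiring (Finset.Ioc 1 m) (angle c u)
  rw [angleLeft, angleRight]
  refine ⟨_, add_mem (mul_mem (mul_mem (of_mem_nonnegSubsemiring ((u 1)⁻¹ * u (r + 1) * e))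
    (of_mem_nonnegSubsemiring e⁻¹)) hA) (mul_mem (mul_mem hB (of_mem_nonnegSubsemiring e⁻¹))
    (add_mem (of_mem_nonnegSubsemiring ((u (r + 1))⁻¹ * u 1 * d)) hA)), ?_⟩
  have key : of ℤ G ((u 1)⁻¹ * u (r + 1) * e) * of ℤ G e⁻¹ * of ℤ G ((u (r + 1))⁻¹ * u 1 * d) =
      of ℤ G d := by rw [← map_mul, ← map_mul]; congr 1; group
  rw [← key]
  noncomm_ring

theorem of_mul_of_inv (g : G) : of ℤ G g * of ℤ G g⁻¹ = 1 := by rw [← map_mul]; simp [one_def]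

theorem of_inv_mul_of (g : G) : of ℤ G g⁻¹ * of ℤ G g = 1 := by rw [← map_mul]; simp [one_def]

theorem mem_closure_of_augmentation_pos {x : MonoidAlgebra ℤ G} (hx : x ∈ nonnegSubsemiring G)
    (h : 0 < augmentation G x) : x ∈ AddSubsemigroup.closure (Set.range (of ℤ G)) :=
  (eq_zero_or_mem_closure hx).resolve_left (by rintro rfl; simp at h)

/-- The bi-infinite sequence `U_{m + kr}` for an even index `m`. -/
theorem exists_seq_even (w : G) (m : ℤ) (h1 : 1 ≤ m) (h2 : m ≤ r + 1) :
    ∃ W : ℤ → MonoidAlgebra ℤ G, W 0 = of ℤ G w ∧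
      of ℤ G d * W 1 = angleLeft e c u r m * W 0 ∧
      (∀ k, of ℤ G e * W (k - 1) + of ℤ G d * W (k + 1) = angleTotal d e c u r * W k) ∧
      ∀ k, W k ∈ AddSubsemigroup.closure (Set.range (of ℤ G)) := by
  obtain ⟨p, hp, hab⟩ := exists_angleRight_mul_angleLeft d e c u r m
  obtain ⟨q, hq, hba⟩ := exists_angleLeft_mul_angleRight d e c u r m
  obtain ⟨W, h0, hW1, hW, hpos⟩ := exists_pos_linearRecurrence (nonnegSubsemiring G)
    (augmentation G) (fun _ => augmentation_nonneg) (of_mul_of_inv d) (of_inv_mul_of d)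
    (of_mul_of_inv e) (of_inv_mul_of e) (of_mem_nonnegSubsemiring _) (of_mem_nonnegSubsemiring _)
    (angleRight_mem d c u r m) (augmentation_angleRight_pos d c u r m) (angleLeft_mem e c u r m)
    (augmentation_angleLeft_pos e c u r m) hp hq hab hba (of_mem_nonnegSubsemiring w)
    (by rw [augmentation_of]; exact one_pos)
  rw [angleRight_add_angleLeft d e c u r h1 h2] at hW
  exact ⟨W, h0, h0 ▸ hW1, hW, fun k => mem_closure_of_augmentation_pos (hpos k).1 (hpos k).2⟩

/-- The bi-infinite sequence `U_{m + kr}` for an odd index `m`. -/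
theorem exists_seq_odd (w : G) (m : ℤ) (h1 : 1 ≤ m) (h2 : m ≤ r + 1) :
    ∃ W : ℤ → MonoidAlgebra ℤ G, W 0 = of ℤ G w ∧
      W 1 * of ℤ G e = W 0 * angleLeft e c u r m ∧
      (∀ k, W (k - 1) * of ℤ G d + W (k + 1) * of ℤ G e = W k * angleTotal d e c u r) ∧
      ∀ k, W k ∈ AddSubsemigroup.closure (Set.range (of ℤ G)) := by
  obtain ⟨p, hp, hab⟩ := exists_angleRight_mul_angleLeft d e c u r m
  obtain ⟨q, hq, hba⟩ := exists_angleLeft_mul_angleRight d e c u r m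
  obtain ⟨W, h0, hW1, hW, hpos⟩ := exists_pos_linearRecurrence_right (nonnegSubsemiring G)
    (augmentation G) (fun _ => augmentation_nonneg) (of_mul_of_inv d) (of_inv_mul_of d)
    (of_mul_of_inv e) (of_inv_mul_of e) (of_mem_nonnegSubsemiring _) (of_mem_nonnegSubsemiring _)
    (angleRight_mem d c u r m) (augmentation_angleRight_pos d c u r m) (angleLeft_mem e c u r m)
    (augmentation_angleLeft_pos e c u r m) hp hq hab hba (of_mem_nonnegSubsemiring w)
    (by rw [augmentation_of]; exact one_pos)
  rw [angleRight_add_angleLeft d e c u r h1 h2] at hW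
  exact ⟨W, h0, h0 ▸ hW1, hW, fun k => mem_closure_of_augmentation_pos (hpos k).1 (hpos k).2⟩

/-- The interlaced sequences for all residues modulo `r`. -/
theorem exists_seq (hr : 1 ≤ r) (hr2 : Even r) :
    ∃ U : ℤ → MonoidAlgebra ℤ G,
      (∀ m : ℤ, 1 ≤ m → m ≤ r → U m = of ℤ G (u m)) ∧
      (∀ m : ℤ, 1 ≤ m → m ≤ r → Even m → of ℤ G d * U (m + r) = angleLeft e c u r m * U m) ∧
      (∀ m : ℤ, 1 ≤ m → m ≤ r → Odd m → U (m + r) * of ℤ G e = U m * angleLeft e c u r m) ∧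
      (∀ n, Even n →
        of ℤ G e * U (n - r) + of ℤ G d * U (n + r) = angleTotal d e c u r * U n) ∧
      (∀ n, Odd n →
        U (n - r) * of ℤ G d + U (n + r) * of ℤ G e = U n * angleTotal d e c u r) ∧
      ∀ n, U n ∈ AddSubsemigroup.closure (Set.range (of ℤ G)) := by
  have hr0 : (0 : ℤ) < r := by exact_mod_cast hr
  have hrZ : Even (r : ℤ) := by exact_mod_cast hr2
  have main : ∀ m : ℤ, ∃ W : ℤ → MonoidAlgebra ℤ G, 1 ≤ m → m ≤ r → W 0 = of ℤ G (u m) ∧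
      (Even m → of ℤ G d * W 1 = angleLeft e c u r m * W 0) ∧
      (Odd m → W 1 * of ℤ G e = W 0 * angleLeft e c u r m) ∧
      (Even m → ∀ k,
        of ℤ G e * W (k - 1) + of ℤ G d * W (k + 1) = angleTotal d e c u r * W k) ∧
      (Odd m → ∀ k,
        W (k - 1) * of ℤ G d + W (k + 1) * of ℤ G e = W k * angleTotal d e c u r) ∧
      ∀ k, W k ∈ AddSubsemigroup.closure (Set.range (of ℤ G)) := fun m => by
    by_cases hm : 1 ≤ m ∧ m ≤ r
    · rcases Int.even_or_odd m with hp | hp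
      · obtain ⟨W, h0, h1, hW, hpos⟩ := exists_seq_even d e c u r (u m) m hm.1 (by omega)
        have := Int.not_odd_iff_even.2 hp
        exact ⟨W, fun _ _ => by tauto⟩
      · obtain ⟨W, h0, h1, hW, hpos⟩ := exists_seq_odd d e c u r (u m) m hm.1 (by omega)
        have := Int.not_even_iff_odd.2 hp
        exact ⟨W, fun _ _ => by tauto⟩
    · exact ⟨0, fun h1 h2 => absurd ⟨h1, h2⟩ hm⟩
  choose W hW using main
  have hmod : ∀ n : ℤ, 1 ≤ (n - 1) % r + 1 ∧ (n - 1) % r + 1 ≤ r := fun n => by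
    have := Int.emod_nonneg (n - 1) hr0.ne'
    have := Int.emod_lt_of_pos (n - 1) hr0
    omega
  have hpar : ∀ n : ℤ, Even ((n - 1) % r + 1) ↔ Even n := fun n => by
    have := Int.emod_add_mul_ediv (n - 1) r
    have h : n = ((n - 1) % r + 1) + r * ((n - 1) / r) := by omega
    rw [iff_comm]
    nth_rw 1 [h]
    rw [Int.even_add (n := r * _)]
    simp [hrZ]
  have hpar' : ∀ n : ℤ, Odd ((n - 1) % r + 1) ↔ Odd n := fun n => by
    rw [← Int.not_even_iff_odd, hpar, Int.not_even_iff_odd]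
  -- The shift by one makes the residue representatives run over `1, …, r`. As `r` is even, the
  -- parity of `n` is that of its representative.
  let U : ℤ → MonoidAlgebra ℤ G := fun n => W ((n - 1) % r + 1) ((n - 1) / r)
  have hU0 : ∀ m : ℤ, 1 ≤ m → m ≤ r → U m = W m 0 := fun m h1 h2 => by
    simp only [U]
    rw [Int.emod_eq_of_lt (by omega) (by omega), Int.ediv_eq_zero_of_lt (by omega) (by omega),
      sub_add_cancel]
  have hadd : ∀ n, U (n + r) = W ((n - 1) % r + 1) ((n - 1) / r + 1) := fun n => by
    simp only [U]
    rw [show n + (r : ℤ) - 1 = n - 1 + r by ring, Int.add_emod_right,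
      Int.add_ediv_of_dvd_right dvd_rfl, Int.ediv_self hr0.ne']
  have hsub : ∀ n, U (n - r) = W ((n - 1) % r + 1) ((n - 1) / r - 1) := fun n => by
    simp only [U]
    rw [show n - (r : ℤ) - 1 = n - 1 - r by ring, Int.sub_emod_right,
      Int.sub_ediv_of_dvd _ dvd_rfl, Int.ediv_self hr0.ne']
  have hU1 : ∀ m : ℤ, 1 ≤ m → m ≤ r → U (m + r) = W m 1 := fun m h1 h2 => by
    rw [hadd, Int.emod_eq_of_lt (by omega) (by omega),
      Int.ediv_eq_zero_of_lt (by omega) (by omega), sub_add_cancel, zero_add]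
  refine ⟨U, fun m h1 h2 => ?_, fun m h1 h2 hm => ?_, fun m h1 h2 hm => ?_, fun n hn => ?_,
    fun n hn => ?_, fun n => ?_⟩
  · rw [hU0 m h1 h2, (hW m h1 h2).1]
  · rw [hU0 m h1 h2, hU1 m h1 h2, (hW m h1 h2).2.1 hm]
  · rw [hU0 m h1 h2, hU1 m h1 h2, (hW m h1 h2).2.2.1 hm]
  · rw [hadd, hsub, (hW _ (hmod n).1 (hmod n).2).2.2.2.1 ((hpar n).2 hn)]
  · rw [hadd, hsub, (hW _ (hmod n).1 (hmod n).2).2.2.2.2.1 ((hpar' n).2 hn)]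
  · exact (hW _ (hmod n).1 (hmod n).2).2.2.2.2.2 _

/-- A positive sequence with given initial terms that solves both the exchange relations and a linear
recurrence with constant coefficients. -/
theorem exists_exchange_sequence (hr : 1 ≤ r) (hr2 : Even r) (hc : Function.Periodic c (r : ℤ)) :
    ∃ (U : ℤ → MonoidAlgebra ℤ G) (H : MonoidAlgebra ℤ G),
      (∀ m : ℤ, 1 ≤ m → m ≤ r + 1 → U m = of ℤ G (u m)) ∧
      (∀ n, Even n → U (n - r - 1) * of ℤ G d * U n =
        of ℤ G (c n) + U (n - 1) * of ℤ G e * U (n - r)) ∧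
      (∀ n, Odd n → U n * of ℤ G e * U (n - r - 1) =
        of ℤ G (c n) + U (n - r) * of ℤ G d * U (n - 1)) ∧
      (∀ n, Even n →
        of ℤ G e * U (n - r) + of ℤ G d * U (n + r) = H * U n) ∧
      (∀ n, Odd n →
        U (n - r) * of ℤ G d + U (n + r) * of ℤ G e = U n * H) ∧
      ∀ n, U n ∈ AddSubsemigroup.closure (Set.range (of ℤ G)) := by
  have hr0 : (0 : ℤ) < r := by exact_mod_cast hr
  have hrZ : Even (r : ℤ) := by exact_mod_cast hr2
  obtain ⟨U, hU, hUe, hUo, hLe, hLo, hpos⟩ := exists_seq d e c u r hr hr2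
  -- The index `r + 1` lies in the class of `1`, so its value is not prescribed; it comes out right
  -- because at `m = 1` the left angle is just the corner `u_1⁻¹ u_{r+1} e`.
  have hlast : U (r + 1) = of ℤ G (u (r + 1)) := by
    have h := hUo 1 le_rfl (by omega) odd_one
    have h' := congrArg (· * of ℤ G e⁻¹) h
    simp only [mul_assoc, of_mul_of_inv, mul_one] at h'
    rw [add_comm, h', hU 1 le_rfl (by omega), angleLeft, Finset.Ioc_self, Finset.sum_empty,
      add_zero, ← map_mul, ← map_mul]
    congr 1; group
  have hU' : ∀ m : ℤ, 1 ≤ m → m ≤ r + 1 → U m = of ℤ G (u m) := fun m h1 h2 => by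
    rcases h2.lt_or_eq with h | rfl
    · exact hU m h1 (by omega)
    · exact hlast
  have hUo' : ∀ m : ℤ, 1 ≤ m → m ≤ r + 1 → Odd m →
      U (m + r) * of ℤ G e = U m * angleLeft e c u r m := fun m h1 h2 hm => by
    rcases h2.lt_or_eq with h | rfl
    · exact hUo m h1 (by omega) hm
    -- For `m = r + 1` the linear recurrence gives the claim once the second corner term is
    -- cancelled: `U_{r+1}` times that corner is `U_1 d`.
    · have h := hLo _ hm
      have e1 : U (r + 1) * of ℤ G ((u (r + 1))⁻¹ * u 1 * d) = U 1 * of ℤ G d := by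
        rw [hlast, hU 1 le_rfl (by omega), ← map_mul, ← map_mul]; congr 1; group
      rw [angleTotal, mul_add, e1, add_sub_cancel_left, add_comm] at h
      exact add_right_cancel h
  have hUe' : ∀ m : ℤ, 1 ≤ m → m ≤ r + 1 → Even m →
      of ℤ G d * U (m + r) = angleLeft e c u r m * U m := fun m h1 h2 hm => by
    refine hUe m h1 ?_ hm
    rcases h2.lt_or_eq with h | rfl
    · omega
    · exact absurd hm (by simpa using hrZ.add_one)
  -- The exchange defect, to be identified with `c n`.
  let E : ℤ → MonoidAlgebra ℤ G := fun n =>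
    if Even n then U (n - r - 1) * of ℤ G d * U n - U (n - 1) * of ℤ G e * U (n - r)
    else U n * of ℤ G e * U (n - r - 1) - U (n - r) * of ℤ G d * U (n - 1)
  -- For even `n`, `E (n + r) - E n` is `U (n - 1) * (H * U n) - (U (n - 1) * H) * U n = 0`: the
  -- recurrences at `n` and `n - 1` have `H` on opposite sides. Odd `n` is the mirror image.
  have hEper : Function.Periodic E (r : ℤ) := fun n => by
    have e2 : n + (r : ℤ) - r = n := by ring
    have e3 : n + (r : ℤ) - 1 = n - 1 + r := by ring
    have e4 : n - (r : ℤ) - 1 = n - 1 - r := by ring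
    have hp : Even (n + (r : ℤ)) ↔ Even n := by simp [Int.even_add, hrZ]
    simp only [E, hp, e2, e3, e4]
    split_ifs with hn
    · have l1 := hLe n hn
      have l2 := hLo (n - 1) (hn.sub_odd odd_one)
      linear_combination (norm := noncomm_ring) U (n - 1) * l1 - l2 * U n
    · rw [Int.not_even_iff_odd] at hn
      have l1 := hLo n hn
      have l2 := hLe (n - 1) (hn.sub_odd odd_one)
      linear_combination (norm := noncomm_ring) l1 * U (n - 1) - U n * l2
  -- The left angles at `m` and `m - 1` differ by the single angle between `U_{m-1}` and `U_m`,
  -- which gives `c m` after multiplication by these two.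
  have hEbase : ∀ m : ℤ, 2 ≤ m → m ≤ r + 1 → E (m + r) = of ℤ G (c m) := fun m h1 h2 => by
    have e2 : m + (r : ℤ) - r = m := by ring
    have e3 : m + (r : ℤ) - 1 = m - 1 + r := by ring
    have hp : Even (m + (r : ℤ)) ↔ Even m := by simp [Int.even_add, hrZ]
    have hA := angleLeft_sub_one e c u r (m := m) (by omega)
    have v1 := hU' m (by omega) h2
    have v2 := hU' (m - 1) (by omega) (by omega)
    simp only [E, hp, e2, e3]
    split_ifs with hn
    · have l1 := hUe' m (by omega) h2 hn
      have l2 := hUo' (m - 1) (by omega) (by omega) (hn.sub_odd odd_one)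
      have t : U (m - 1) * of ℤ G (angle c u m) * U m = of ℤ G (c m) := by
        rw [v1, v2, angle, if_pos hn, ← map_mul, ← map_mul]; congr 1; group
      rw [l2, mul_assoc, l1, hA, ← t]
      noncomm_ring
    · rw [Int.not_even_iff_odd] at hn
      have l1 := hUo' m (by omega) h2 hn
      have l2 := hUe' (m - 1) (by omega) (by omega) (hn.sub_odd odd_one)
      have t : U m * of ℤ G (angle c u m) * U (m - 1) = of ℤ G (c m) := by
        rw [v1, v2, angle, if_neg (Int.not_even_iff_odd.2 hn), ← map_mul, ← map_mul]
        congr 1; group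
      rw [l1, mul_assoc (U m) (of ℤ G d), l2, hA, ← t]
      noncomm_ring
  have hE : ∀ n, E n = of ℤ G (c n) := fun n => by
    obtain ⟨m, k, hm1, hm2, rfl⟩ : ∃ m k : ℤ, 2 ≤ m ∧ m ≤ r + 1 ∧ n = m + k * r := by
      have := Int.emod_nonneg (n - 2) hr0.ne'
      have := Int.emod_lt_of_pos (n - 2) hr0
      have := Int.emod_add_mul_ediv (n - 2) r
      exact ⟨(n - 2) % r + 2, (n - 2) / r, by omega, by omega, by rw [mul_comm]; omega⟩
    have h1 := hEper.int_mul k m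
    have h2 := hc.int_mul k m
    simp only [Int.cast_id] at h1 h2
    rw [h1, h2, ← hEper m, hEbase m hm1 hm2]
  refine ⟨U, _, hU', fun n hn => ?_, fun n hn => ?_, hLe, hLo, hpos⟩
  · rw [← sub_eq_iff_eq_add, ← hE n]; simp only [E, if_pos hn]
  · rw [← sub_eq_iff_eq_add, ← hE n]; simp only [E, if_neg (Int.not_even_iff_odd.2 hn)]

end GroupRing

/-! ### The triangle group as a free group -/

section TriangleGroup

open FreeGroup (of lift lift_apply_of)

open TGen

theorem ZMod.even_val_natCast {r : ℕ} (hr2 : Even r) (n : ℕ) :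
    Even (n : ZMod r).val ↔ Even n := by
  rw [ZMod.val_natCast, Nat.even_iff, Nat.even_iff, Nat.mod_mod_of_dvd _ hr2.two_dvd]

/-- The generator of `𝕋_r` opposite to `U_{j+1}`. -/
noncomputable def tV (r : ℕ) (j : Fin (r + 1)) : TGroup r :=
  if Even ((j : ℕ) + 1) then PresentedGroup.of (xbar j) else PresentedGroup.of (x j)

/-- The generator of a free group that stands for a letter. -/
def freeLetter (r : ℕ) (l : Letter r) : FreeGroup (Letter r ⊕ Fin r) := of (Sum.inl l)

variable {r : ℕ}

theorem tU_last_mul (hr2 : Even r) :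
    tU r (Fin.last r) * tDbar r * tV r 0 = tU r 0 * tD r * tV r (Fin.last r) := by
  have h1 : ¬ Even (r + 1) := Nat.not_even_iff_odd.2 hr2.add_one
  have h := PresentedGroup.one_of_mem (rels := tRels r) (Or.inl rfl)
  simp only [map_mul, map_inv, mul_inv_eq_one] at h
  simp only [tU, tV, Fin.val_last, h1, tD, tDbar, Fin.val_zero, zero_add, Nat.not_even_one,
    if_false]
  exact h

theorem t_triangle (i : Fin r) :
    (PresentedGroup.of (x i.castSucc) : TGroup r) *
      (PresentedGroup.of (cbar (((i : ℕ) + 2 : ℕ) : ZMod r)))⁻¹ * PresentedGroup.of (xbar i.succ) =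
    PresentedGroup.of (x i.succ) * (PresentedGroup.of (c (((i : ℕ) + 2 : ℕ) : ZMod r)))⁻¹ *
      PresentedGroup.of (xbar i.castSucc) := by
  have h := PresentedGroup.one_of_mem (rels := tRels r) (Or.inr ⟨i, rfl⟩)
  simp only [map_mul, map_inv, mul_inv_eq_one] at h
  exact h

/-- The homomorphism from a free group to `𝕋_r`. -/
noncomputable def freeToT' : FreeGroup (Letter r ⊕ Fin r) →* TGroup r :=
  FreeGroup.lift (Sum.elim (Letter.toT r) fun i => tV r i.succ)

theorem freeToT'_freeLetter (l : Letter r) : freeToT' (freeLetter r l) = l.toT r := by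
  simp [freeToT', freeLetter]

variable (r) [NeZero r]

/-- The representative of a residue. -/
def residueFin (z : ZMod r) : Fin r := ⟨z.val, z.val_lt⟩

theorem residueFin_natCast (i : Fin r) : residueFin r ((i : ℕ) : ZMod r) = i :=
  Fin.ext (ZMod.val_natCast_of_lt i.2)

/-- The element of a free group that stands for the opposite of `U_{j+1}`. -/
def freeV : Fin (r + 1) → FreeGroup (Letter r ⊕ Fin r) :=
  Fin.cases ((freeLetter r .Dbar)⁻¹ * (freeLetter r (.U (Fin.last r)))⁻¹ * freeLetter r (.U 0) *
    freeLetter r .D * of (Sum.inr (Fin.rev 0))) fun i => of (Sum.inr i)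

/-- The expression of the generators of `𝕋_r` in terms of a free generating set. -/
def tGenFree : TGen r → FreeGroup (Letter r ⊕ Fin r)
  | .x i => if Even ((i : ℕ) + 1) then freeLetter r (.U i) else freeV r i
  | .xbar i => if Even ((i : ℕ) + 1) then freeV r i else freeLetter r (.U i)
  -- Exactly one of `c_z`, `c̄_z` is a letter; the other is obtained by solving the triangle
  -- relation. The letter `C i` stands for `C_{i+1}` and the `i`-th relation concerns `s = i + 2`,
  -- hence `z - 1` and `z - 2`. Evenness of `r` makes the parity of a residue meaningful.
  | .c z => if Even z.val then freeLetter r (.C (residueFin r (z - 1))) else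
      freeV r (residueFin r (z - 2)).castSucc * (freeLetter r (.U (residueFin r (z - 2)).castSucc) *
        (freeLetter r (.C (residueFin r (z - 1))))⁻¹ *
          freeLetter r (.U (residueFin r (z - 2)).succ))⁻¹ * freeV r (residueFin r (z - 2)).succ
  | .cbar z => if Even z.val then
      freeV r (residueFin r (z - 2)).succ * (freeLetter r (.U (residueFin r (z - 2)).succ) *
        (freeLetter r (.C (residueFin r (z - 1))))⁻¹ *
          freeLetter r (.U (residueFin r (z - 2)).castSucc))⁻¹ *
            freeV r (residueFin r (z - 2)).castSucc
      else freeLetter r (.C (residueFin r (z - 1)))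
  | .d => (freeLetter r .D)⁻¹
  | .dbar => (freeLetter r .Dbar)⁻¹

theorem freeV_last : freeV r (Fin.last r) = of (Sum.inr (Fin.rev 0)) := by
  have h : Fin.last r = Fin.succ (Fin.rev (0 : Fin r)) := by
    ext; have := NeZero.pos r; simp; omega
  rw [h]; rfl

variable {r}

theorem tGenFree_rels (hr2 : Even r) : ∀ w ∈ tRels r, FreeGroup.lift (tGenFree r) w = 1 := by
  have h1 : ¬ Even (r + 1) := Nat.not_even_iff_odd.2 hr2.add_one
  rintro w (rfl | ⟨i, rfl⟩)
  · simp only [map_mul, map_inv, lift_apply_of, mul_inv_eq_one, tGenFree, Fin.val_last, h1,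
      Fin.val_zero, freeV_last]
    simp [freeV]
    group
  · have e1 : (((i : ℕ) + 2 : ℕ) : ZMod r) - 2 = (i : ℕ) := by push_cast; ring
    have e2 := ZMod.even_val_natCast hr2 ((i : ℕ) + 2)
    simp only [map_mul, map_inv, lift_apply_of, mul_inv_eq_one, tGenFree, e1, e2,
      residueFin_natCast, Fin.val_castSucc, Fin.val_succ]
    by_cases hi : Even (i : ℕ) <;> simp [hi, parity_simps]

/-- The homomorphism from `𝕋_r` to a free group. -/
noncomputable def tToFree (hr2 : Even r) : TGroup r →* FreeGroup (Letter r ⊕ Fin r) :=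
  PresentedGroup.toGroup (tGenFree_rels hr2)

theorem tToFree_of (hr2 : Even r) (g : TGen r) :
    tToFree hr2 (PresentedGroup.of g) = tGenFree r g :=
  PresentedGroup.toGroup.of _

theorem tToFree_freeToT (hr2 : Even r) (l : Letter r) :
    tToFree hr2 (l.toT r) = freeLetter r l := by
  cases l with
  | D => simp [Letter.toT, tD, tToFree_of, tGenFree]
  | Dbar => simp [Letter.toT, tDbar, tToFree_of, tGenFree]
  | C i =>
    have e1 : ((((i : ℕ) + 1 : ℕ) : ℤ) : ZMod r) - 1 = (i : ℕ) := by push_cast; ring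
    have e2 := ZMod.even_val_natCast hr2 ((i : ℕ) + 1)
    have e3 : ((i : ℕ) : ℤ) + 1 = ((i + 1 : ℕ) : ℤ) := by push_cast; rfl
    rw [Letter.toT, tC, e3]
    rw [Int.cast_natCast] at e1
    split_ifs with h
    · rw [Int.even_coe_nat, ← e2] at h
      rw [Int.cast_natCast, tToFree_of]
      simp only [tGenFree, if_pos h, e1, residueFin_natCast]
    · rw [Int.even_coe_nat, ← e2] at h
      rw [Int.cast_natCast, tToFree_of]
      simp only [tGenFree, if_neg h, e1, residueFin_natCast]
  | U j =>
    rw [Letter.toT, tU]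
    split_ifs with h <;> simp [tToFree_of, tGenFree, h]

/-- Followed by `tToFree`, the map becomes the inclusion of a free factor. -/
theorem freeToT_injective (hr2 : Even r) : Function.Injective (freeToT r) := by
  have h : (tToFree hr2).comp (freeToT r) = FreeGroup.map Sum.inl := by
    ext l
    simp [freeToT, tToFree_freeToT, freeLetter]
  have h2 : Function.Injective ((tToFree hr2).comp (freeToT r)) := by
    rw [h]; exact FreeGroup.map_injective Sum.inl_injective
  exact Function.Injective.of_comp h2

theorem freeToT'_freeV (hr2 : Even r) (j : Fin (r + 1)) : freeToT' (freeV r j) = tV r j := by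
  cases j using Fin.cases with
  | zero =>
    have h : Fin.succ (Fin.rev (0 : Fin r)) = Fin.last r := by
      ext; have := NeZero.pos r; simp; omega
    simp only [freeV, freeToT', freeLetter, Fin.cases_zero, map_mul, map_inv, lift_apply_of,
      Sum.elim_inl, Sum.elim_inr, h, Letter.toT]
    have := tU_last_mul hr2
    rw [mul_assoc _ (tD r), mul_assoc _ (tU r 0), ← mul_assoc (tU r 0), ← this]
    group
  | succ i => simp [freeV, freeToT']

theorem toT_C (hr2 : Even r) (z : ZMod r) : (Letter.C (residueFin r (z - 1))).toT r =
    if Even z.val then PresentedGroup.of (c z) else PresentedGroup.of (cbar z) := by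
  have e1 : (((((residueFin r (z - 1) : Fin r) : ℕ) : ℤ) + 1 : ℤ) : ZMod r) = z := by
    simp [residueFin]
  have e2 := ZMod.even_val_natCast hr2 ((residueFin r (z - 1) : ℕ) + 1)
  rw [show (((residueFin r (z - 1) : ℕ) + 1 : ℕ) : ZMod r) = z by simp [residueFin]] at e2
  rw [Letter.toT, tC, e1]
  have e3 : Even (((residueFin r (z - 1) : ℕ) : ℤ) + 1) ↔ Even z.val := by
    rw [e2]; exact_mod_cast Int.even_coe_nat _
  simp only [e3]

/-- `freeToT'` is a left inverse. On generators this says that the eliminated ones, the opposite of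
`U_1` and one of each pair `c_z`, `c̄_z`, are recovered from the defining relations. -/
theorem tToFree_injective (hr2 : Even r) : Function.Injective (tToFree hr2) := by
  have h : freeToT'.comp (tToFree hr2) = MonoidHom.id (TGroup r) := by
    ext g
    simp only [MonoidHom.comp_apply, MonoidHom.id_apply, tToFree_of]
    have key : ∀ z : ZMod r, z = (((residueFin r (z - 2) : ℕ) + 2 : ℕ) : ZMod r) := fun z => by
      simp [residueFin]
    cases g with
    | x i =>
      simp only [tGenFree]
      split_ifs with h <;>
        simp [freeToT'_freeV hr2, freeToT'_freeLetter, Letter.toT, tU, tV, h]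
    | xbar i =>
      simp only [tGenFree]
      split_ifs with h <;>
        simp [freeToT'_freeV hr2, freeToT'_freeLetter, Letter.toT, tU, tV, h]
    | c z =>
      simp only [tGenFree]
      have ht := t_triangle (residueFin r (z - 2))
      have e2 := ZMod.even_val_natCast hr2 ((residueFin r (z - 2) : ℕ) + 2)
      rw [← key z] at ht e2
      split_ifs with h
      · rw [freeToT'_freeLetter, toT_C hr2, if_pos h]
      · have h' : ¬ Even (residueFin r (z - 2) : ℕ) := by
          rw [e2] at h; simpa [parity_simps] using h
        simp only [map_mul, map_inv, freeToT'_freeV hr2, freeToT'_freeLetter, toT_C hr2, if_neg h]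
        simp only [Letter.toT, tU, tV, Fin.val_castSucc, Fin.val_succ, Nat.even_add_one, h',
          not_true, not_false_iff, if_true, if_false]
        rw [ht]; group
    | cbar z =>
      simp only [tGenFree]
      have ht := t_triangle (residueFin r (z - 2))
      have e2 := ZMod.even_val_natCast hr2 ((residueFin r (z - 2) : ℕ) + 2)
      rw [← key z] at ht e2
      split_ifs with h
      · have h' : Even (residueFin r (z - 2) : ℕ) := by
          rw [e2] at h; simpa [parity_simps] using h
        simp only [map_mul, map_inv, freeToT'_freeV hr2, freeToT'_freeLetter, toT_C hr2, if_pos h]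
        simp only [Letter.toT, tU, tV, Fin.val_castSucc, Fin.val_succ, Nat.even_add_one, h',
          not_true, not_false_iff, if_true, if_false]
        rw [← ht]; group
      · rw [freeToT'_freeLetter, toT_C hr2, if_neg h]
    | d => simp [tGenFree, freeToT'_freeLetter, Letter.toT, tD]
    | dbar => simp [tGenFree, freeToT'_freeLetter, Letter.toT, tDbar]
  intro a b hab
  simpa using congrArg freeToT' hab |>.trans (DFunLike.congr_fun h b) |>.symm.trans
    (DFunLike.congr_fun h a) |>.symm

theorem uniqueProds_tGroup (hr2 : Even r) : UniqueProds (TGroup r) :=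
  UniqueProds.of_injective_mulHom (tToFree hr2).toMulHom (tToFree_injective hr2) inferInstance

end TriangleGroup

/-! ### Invertibility in the localization and uniqueness of solutions -/

theorem isFull_of_ne_zero {R : Type*} [Ring R] {a : R} (ha : a ≠ 0) :
    IsFull (fun _ _ => a : Matrix (Fin 1) (Fin 1) R) := by
  intro p B C h
  by_contra! hp
  obtain rfl : p = 0 := by omega
  exact ha (by simpa [Matrix.mul_apply] using congrFun (congrFun h 0) 0)

theorem isUnit_toFrac {R : Type*} [Ring R] {a : R} (ha : a ≠ 0) : IsUnit (toFrac R a) := by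
  have h := isFull_of_ne_zero ha
  have h1 := RingQuot.mkRingHom_rel (FracRel.mul_inv 1 _ h 0 0)
  have h2 := RingQuot.mkRingHom_rel (FracRel.inv_mul 1 _ h 0 0)
  simp only [Fin.sum_univ_one, if_true, map_mul, map_one] at h1 h2
  exact ⟨⟨toFrac R a, _, h1, h2⟩, rfl⟩

/-- A solution of the exchange recursion with regular terms is determined by `r + 1` consecutive
terms. -/
theorem exchange_unique {A : Type*} [Ring A] {r : ℕ} (hr : 1 ≤ r) {d e : A} {c X Y : ℤ → A}
    (hd : IsRegular d) (he : IsRegular e) (hY : ∀ n, IsRegular (Y n))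
    (h : ∀ n : ℤ, 1 ≤ n → n ≤ r + 1 → X n = Y n)
    (hXe : ∀ n, Even n → X (n - r - 1) * d * X n = c n + X (n - 1) * e * X (n - r))
    (hXo : ∀ n, Odd n → X n * e * X (n - r - 1) = c n + X (n - r) * d * X (n - 1))
    (hYe : ∀ n, Even n → Y (n - r - 1) * d * Y n = c n + Y (n - 1) * e * Y (n - r))
    (hYo : ∀ n, Odd n → Y n * e * Y (n - r - 1) = c n + Y (n - r) * d * Y (n - 1)) : X = Y := by
  -- The interval of agreement grows by one index at each end: each relation involves `r + 2`
  -- consecutive indices, and its extreme term is cancelled against a regular factor.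
  have key : ∀ k : ℕ, ∀ n : ℤ, 1 - k ≤ n → n ≤ r + 1 + k → X n = Y n := by
    intro k
    induction k with
    | zero => simpa using h
    | succ k ih =>
      intro n h1 h2
      push_cast at h1 h2
      by_cases hn1 : n = r + 2 + k
      · have i1 := ih (n - r - 1) (by omega) (by omega)
        have i2 := ih (n - r) (by omega) (by omega)
        have i3 := ih (n - 1) (by omega) (by omega)
        rcases Int.even_or_odd n with hn | hn
        · have := hXe n hn
          rw [i1, i2, i3, ← hYe n hn] at this
          exact ((hY _).mul hd).left this
        · have := hXo n hn
          rw [i1, i2, i3, ← hYo n hn, mul_assoc, mul_assoc] at this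
          exact (he.mul (hY _)).right this
      by_cases hn2 : n = -k
      · obtain ⟨m, rfl⟩ : ∃ m, n = m - r - 1 := ⟨n + r + 1, by ring⟩
        have i1 := ih m (by omega) (by omega)
        have i2 := ih (m - r) (by omega) (by omega)
        have i3 := ih (m - 1) (by omega) (by omega)
        rcases Int.even_or_odd m with hm | hm
        · have := hXe m hm
          rw [i1, i2, i3, ← hYe m hm, mul_assoc, mul_assoc] at this
          exact (hd.mul (hY _)).right this
        · have := hXo m hm
          rw [i1, i2, i3, ← hYo m hm] at this
          exact ((hY _).mul he).left this
      exact ih n (by omega) (by omega)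
  funext n
  exact key (n.natAbs + 1) n (by omega) (by omega)

/-! ### The recursion in the annulus algebra -/

section Curves

open Vertex

variable (r : ℕ)

theorem curve_exchange (a b c d : Vertex) (h : IsQuad a b c d) :
    (curve r b d : AnnulusAlg r) =
      ↑(curve r b a * (curve r c a)⁻¹ * curve r c d) +
        ↑(curve r b c * (curve r a c)⁻¹ * curve r a d) := by
  have h := RingQuot.mkAlgHom_rel ℚ (CurveRel.exchange (r := r) a b c d h)
  simp only [map_mul, map_add] at h
  exact h

theorem curve_inner_outer_one (n : ℤ) :
    curve r (inner n) (outer 1) = xbarCurve r (n - r) := by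
  rw [xbarCurve, ← curve_deck r (inner (n - r))]; simp [shift]

theorem curve_outer_one_inner (n : ℤ) :
    curve r (outer 1) (inner n) = xCurve r (n - r) := by
  rw [xCurve, ← curve_deck r _ (inner (n - r))]; simp [shift]

theorem triangle_outer (n : ℤ) :
    xbarCurve r (n - r) * (dCurve r)⁻¹ * xCurve r n =
      xbarCurve r n * (dbarCurve r)⁻¹ * xCurve r (n - r) := by
  rw [← curve_inner_outer_one, ← curve_outer_one_inner]
  exact curve_triangle r (inner n) (outer 1) (outer 0) (by simp) (by simp) (by simp)

/-- Exchange in the quadrilateral `p_{n-1}, p_n` and two adjacent lifts of `p`, for the diagonal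
from `inner (n - 1)` to `outer 1`, multiplied on the right by `d⁻¹ x_n`; the outer triangle relation
rewrites the last term. The other parity uses the other diagonal. -/
theorem xbarCurve_mul_xCurve (n : ℤ) :
    (↑(xbarCurve r (n - r - 1) * (dCurve r)⁻¹ * xCurve r n) : AnnulusAlg r) =
      cCurve r n + ↑(xbarCurve r (n - 1) * (dbarCurve r)⁻¹ * xCurve r (n - r)) := by
  have h := curve_exchange r (inner n) (inner (n - 1)) (outer 0) (outer 1)
    (Or.inr (Or.inr (Or.inl ⟨by simp [Before], by simp [Before], by simp [Before]⟩)))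
  rw [curve_inner_outer_one, curve_inner_outer_one, sub_right_comm] at h
  change _ = (↑(cCurve r n * (xCurve r n)⁻¹ * dCurve r) : AnnulusAlg r) +
    ↑(xbarCurve r (n - 1) * (xbarCurve r n)⁻¹ * xbarCurve r (n - r)) at h
  rw [mul_assoc, Units.val_mul, h, add_mul, ← Units.val_mul, ← Units.val_mul]
  congr 2
  · group
  · rw [mul_assoc, ← mul_assoc (xbarCurve r (n - r)), triangle_outer]; group

theorem xbarCurve_mul_xCurve' (n : ℤ) :
    (↑(xbarCurve r n * (dbarCurve r)⁻¹ * xCurve r (n - r - 1)) : AnnulusAlg r) =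
      cbarCurve r n + ↑(xbarCurve r (n - r) * (dCurve r)⁻¹ * xCurve r (n - 1)) := by
  have h := curve_exchange r (outer 1) (inner n) (inner (n - 1)) (outer 0)
    (Or.inr (Or.inr (Or.inr ⟨by simp [Before], by simp [Before], by simp [Before]⟩)))
  rw [curve_inner_outer_one, curve_inner_outer_one, curve_outer_one_inner, sub_right_comm,
    add_comm] at h
  change (xbarCurve r n : AnnulusAlg r) =
    ↑(cbarCurve r n * (xCurve r (n - r - 1))⁻¹ * dbarCurve r) +
    ↑(xbarCurve r (n - r) * (xbarCurve r (n - r - 1))⁻¹ * xbarCurve r (n - 1)) at h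
  have ht := triangle_outer r (n - 1)
  rw [sub_right_comm] at ht
  rw [mul_assoc, Units.val_mul, h, add_mul, ← Units.val_mul, ← Units.val_mul]
  congr 2
  · group
  · rw [mul_assoc, ← mul_assoc (xbarCurve r (n - 1)), ← ht]; group

/-- `C_n` as an element of the algebra of the annulus. -/
noncomputable def cUnit (n : ℤ) : (AnnulusAlg r)ˣ := if Even n then cCurve r n else cbarCurve r n

variable {r}

theorem uCurve_even (hr2 : Even r) (n : ℤ) (hn : Even n) :
    (uCurve r (n - r - 1) * ↑(dCurve r)⁻¹ * uCurve r n : AnnulusAlg r) =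
      cUnit r n + uCurve r (n - 1) * ↑(dbarCurve r)⁻¹ * uCurve r (n - r) := by
  have hrZ : Even (r : ℤ) := by exact_mod_cast hr2
  have h1 : ¬ Even (n - r - 1) := by simp [hn, hrZ, parity_simps]
  have h2 : ¬ Even (n - 1) := by simp [hn, parity_simps]
  have h3 : Even (n - r) := hn.sub hrZ
  simp only [uCurve, cUnit, hn, h1, h2, h3, if_true, if_false]
  exact_mod_cast xbarCurve_mul_xCurve r n

theorem uCurve_odd (hr2 : Even r) (n : ℤ) (hn : Odd n) :
    (uCurve r n * ↑(dbarCurve r)⁻¹ * uCurve r (n - r - 1) : AnnulusAlg r) =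
      cUnit r n + uCurve r (n - r) * ↑(dCurve r)⁻¹ * uCurve r (n - 1) := by
  have hrZ : Even (r : ℤ) := by exact_mod_cast hr2
  have h1 : Even (n - r - 1) := (hn.sub_even hrZ).sub_odd odd_one
  have h2 : Even (n - 1) := hn.sub_odd odd_one
  have h3 : ¬ Even (n - r) := Int.not_even_iff_odd.2 (hn.sub_even hrZ)
  rw [← Int.not_even_iff_odd] at hn
  simp only [uCurve, cUnit, hn, h1, h2, h3, if_true, if_false]
  exact_mod_cast xbarCurve_mul_xCurve' r n

theorem toAnnulusAlg_el (g : TGroup r) :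
    toAnnulusAlg r (el g) = PresentedGroup.toGroup (tGenCurve_rels r) g := by
  exact MonoidAlgebra.lift_of _ _

theorem toAnnulusAlg_tD : toAnnulusAlg r (el (tD r)) = ↑(dCurve r)⁻¹ := by
  rw [toAnnulusAlg_el, tD, map_inv, PresentedGroup.toGroup.of, tGenCurve]

theorem toAnnulusAlg_tDbar : toAnnulusAlg r (el (tDbar r)) = ↑(dbarCurve r)⁻¹ := by
  rw [toAnnulusAlg_el, tDbar, map_inv, PresentedGroup.toGroup.of, tGenCurve]

theorem toAnnulusAlg_tC (n : ℤ) : toAnnulusAlg r (el (tC r n)) = cUnit r n := by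
  rw [toAnnulusAlg_el, tC, cUnit]
  split_ifs <;> rw [PresentedGroup.toGroup.of, tGenCurve]
  · rw [cCurve_cast]
  · rw [cbarCurve_cast]

theorem toAnnulusAlg_tU (j : Fin (r + 1)) :
    toAnnulusAlg r (el (tU r j)) = uCurve r ((j : ℕ) + 1) := by
  have h : Even (((j : ℕ) : ℤ) + 1) ↔ Even ((j : ℕ) + 1) := by
    exact_mod_cast Int.even_coe_nat ((j : ℕ) + 1)
  rw [toAnnulusAlg_el, tU, uCurve]
  simp only [h]
  split_ifs <;> rw [PresentedGroup.toGroup.of, tGenCurve]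

theorem toAnnulusAlg_solution (hr : 1 ≤ r) (hr2 : Even r) {U : ℤ → ZT r} (hU : IsSolution r U)
    (n : ℤ) : toAnnulusAlg r (U n) = uCurve r n := by
  refine congrFun (exchange_unique (X := fun n => toAnnulusAlg r (U n))
    (Y := fun n => (uCurve r n : AnnulusAlg r)) hr (dCurve r)⁻¹.isUnit.isRegular
    (dbarCurve r)⁻¹.isUnit.isRegular (fun n => (uCurve r n).isUnit.isRegular)
    (fun n h1 h2 => ?_) (fun n hn => ?_) (fun n hn => ?_) (uCurve_even hr2) (uCurve_odd hr2)) n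
  · obtain ⟨j, rfl⟩ : ∃ j : Fin (r + 1), n = (j : ℕ) + 1 :=
      ⟨⟨(n - 1).toNat, by omega⟩, by simp; omega⟩
    simp only [hU.initial, toAnnulusAlg_tU]
  · simp only [← toAnnulusAlg_tD, ← toAnnulusAlg_tDbar, ← toAnnulusAlg_tC, ← map_mul, ← map_add,
      hU.even n hn]
  · simp only [← toAnnulusAlg_tD, ← toAnnulusAlg_tDbar, ← toAnnulusAlg_tC, ← map_mul, ← map_add,
      hU.odd n hn]

end Curves

/-! ### Transfer from the free group ring to the triangle group ring -/

section Solution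

variable {r : ℕ}

theorem freeAlgToZT_of (g : FreeGroup (Letter r)) :
    freeAlgToZT r (MonoidAlgebra.of ℤ _ g) = el (freeToT r g) := by
  simp [freeAlgToZT]

theorem freeAlgToZT_mem_closure {x : MonoidAlgebra ℤ (FreeGroup (Letter r))}
    (hx : x ∈ AddSubsemigroup.closure (Set.range (MonoidAlgebra.of ℤ (FreeGroup (Letter r))))) :
    freeAlgToZT r x ∈ AddSubsemigroup.closure
      (Set.range fun g : FreeGroup (Letter r) => el (freeToT r g)) := by
  induction hx using AddSubsemigroup.closure_induction with
  | mem x hx =>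
    obtain ⟨g, rfl⟩ := hx
    rw [freeAlgToZT_of]
    exact AddSubsemigroup.subset_closure ⟨g, rfl⟩
  | add x y _ _ hx hy => rw [map_add]; exact add_mem hx hy

/-- The augmentation counts the summands, so it is positive. -/
theorem mapRingHom_ne_zero {x : ZT r} (hx : x ∈ AddSubsemigroup.closure
      (Set.range fun g : FreeGroup (Letter r) => el (freeToT r g))) :
    MonoidAlgebra.mapRingHom (TGroup r) (Int.castRingHom ℚ) x ≠ 0 := by
  suffices h : 0 < MonoidAlgebra.lift ℚ ℚ (TGroup r) 1
      (MonoidAlgebra.mapRingHom (TGroup r) (Int.castRingHom ℚ) x) by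
    intro h0
    simp [h0] at h
  induction hx using AddSubsemigroup.closure_induction with
  | mem x hx =>
    obtain ⟨g, rfl⟩ := hx
    simp
  | add x y _ _ hx hy => rw [map_add, map_add]; exact add_pos hx hy

theorem tC_eq [NeZero r] (hr2 : Even r) (n : ℤ) :
    (Letter.C (residueFin r ((n : ZMod r) - 1))).toT r = tC r n := by
  have h : Even (n : ZMod r).val ↔ Even n := by
    rw [← Int.even_coe_nat, ZMod.val_intCast, Int.even_iff, Int.even_iff,
      Int.emod_emod_of_dvd _ (by exact_mod_cast hr2.two_dvd)]
  rw [toT_C hr2, tC]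
  simp only [h]

theorem isRegular_of_ne_zero_tGroup [NeZero r] (hr2 : Even r) {x : ZT r} (hx : x ≠ 0) :
    IsRegular x :=
  have := uniqueProds_tGroup hr2
  IsRegular.of_ne_zero hx

theorem isRegular_el (g : TGroup r) : IsRegular (el g) :=
  ((Group.isUnit g).map (MonoidAlgebra.of ℤ (TGroup r))).isRegular

theorem exists_solution [NeZero r] (hr2 : Even r) :
    ∃ (U : ℤ → ZT r) (H : MonoidAlgebra ℤ (FreeGroup (Letter r))), IsSolution r U ∧
      (∀ n, U n ∈ AddSubsemigroup.closure
        (Set.range fun g : FreeGroup (Letter r) => el (freeToT r g))) ∧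
      (∀ n, Even n → el (tDbar r) * U (n - r) + el (tD r) * U (n + r) =
        freeAlgToZT r H * U n) ∧
      ∀ n, Odd n → U (n - r) * el (tD r) + U (n + r) * el (tDbar r) =
        U n * freeAlgToZT r H := by
  obtain ⟨U, H, h0, hE, hO, hLe, hLo, hpos⟩ := exists_exchange_sequence
    (FreeGroup.of (Letter.D (r := r))) (FreeGroup.of Letter.Dbar)
    (fun n => FreeGroup.of (Letter.C (residueFin r ((n : ZMod r) - 1))))
    -- Only `1 ≤ n ≤ r + 1` matters here; truncation and reduction give arbitrary values elsewhere.
    (fun n => FreeGroup.of (Letter.U (Fin.ofNat (r + 1) (n - 1).toNat))) r (NeZero.one_le) hr2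
    (fun n => by simp)
  have hD : el (tD r) = freeAlgToZT r (MonoidAlgebra.of ℤ _ (FreeGroup.of Letter.D)) := by
    rw [freeAlgToZT_of, freeToT, FreeGroup.lift_apply_of, Letter.toT]
  have hDbar : el (tDbar r) = freeAlgToZT r (MonoidAlgebra.of ℤ _ (FreeGroup.of Letter.Dbar)) := by
    rw [freeAlgToZT_of, freeToT, FreeGroup.lift_apply_of, Letter.toT]
  have hC : ∀ n : ℤ, el (tC r n) = freeAlgToZT r (MonoidAlgebra.of ℤ _
      (FreeGroup.of (Letter.C (residueFin r ((n : ZMod r) - 1))))) := fun n => by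
    rw [freeAlgToZT_of, freeToT, FreeGroup.lift_apply_of, tC_eq hr2]
  refine ⟨fun n => freeAlgToZT r (U n), H, ⟨fun j => ?_, fun n hn => ?_, fun n hn => ?_⟩,
    fun n => freeAlgToZT_mem_closure (hpos n), fun n hn => ?_, fun n hn => ?_⟩
  · have hj : Fin.ofNat (r + 1) (((j : ℕ) : ℤ) + 1 - 1).toNat = j := by
      ext
      simp
    simp only [h0 ((j : ℕ) + 1) (by omega) (by omega), hj, freeAlgToZT_of]
    rw [freeToT, FreeGroup.lift_apply_of, Letter.toT]
  · simp only [hD, hDbar, hC, ← map_mul, ← map_add, hE n hn]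
  · simp only [hD, hDbar, hC, ← map_mul, ← map_add, hO n hn]
  · simp only [hD, hDbar, ← map_mul, ← map_add, hLe n hn]
  · simp only [hD, hDbar, ← map_mul, ← map_add, hLo n hn]

end Solution

end NCAnnulus

theorem theorem4 (r : ℕ) (hr : 1 ≤ r) (hr2 : Even r) :
    Function.Injective (NCAnnulus.freeToT r) ∧
    ∃ U : ℤ → NCAnnulus.ZT r,
      NCAnnulus.IsSolution r U ∧
      (∀ V : ℤ → NCAnnulus.ZT r, NCAnnulus.IsSolution r V → V = U) ∧
      (∀ n : ℤ, NCAnnulus.toAnnulusAlg r (U n) = (NCAnnulus.uCurve r n : NCAnnulus.AnnulusAlg r)) ∧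
      (∀ n : ℤ, U n ∈ AddSubsemigroup.closure
        (Set.range fun g : FreeGroup (NCAnnulus.Letter r) => NCAnnulus.el (NCAnnulus.freeToT r g))) ∧
      (∀ n : ℤ, IsUnit (NCAnnulus.toFracT r (U n))) ∧
      ∃ H : MonoidAlgebra ℤ (FreeGroup (NCAnnulus.Letter r)), ∀ n : ℤ,
        NCAnnulus.hQuantity r U n = NCAnnulus.toFracT r (NCAnnulus.freeAlgToZT r H) := by
  have : NeZero r := ⟨by omega⟩
  obtain ⟨U, H, hU, hpos, hHe, hHo⟩ := NCAnnulus.exists_solution hr2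
  have hQ := fun n => NCAnnulus.mapRingHom_ne_zero (hpos n)
  have hunit : ∀ n, IsUnit (NCAnnulus.toFracT r (U n)) := fun n => NCAnnulus.isUnit_toFrac (hQ n)
  refine ⟨NCAnnulus.freeToT_injective hr2, U, hU, fun V hV => ?_,
    NCAnnulus.toAnnulusAlg_solution hr hr2 hU, hpos, hunit, H, fun n => ?_⟩
  · refine NCAnnulus.exchange_unique hr (NCAnnulus.isRegular_el (NCAnnulus.tD r))
      (NCAnnulus.isRegular_el (NCAnnulus.tDbar r))
      (fun n => NCAnnulus.isRegular_of_ne_zero_tGroup hr2 fun h => hQ n (by rw [h, map_zero]))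
      (fun n h1 h2 => ?_) hV.even hV.odd hU.even hU.odd
    obtain ⟨j, rfl⟩ : ∃ j : Fin (r + 1), n = (j : ℕ) + 1 :=
      ⟨⟨(n - 1).toNat, by omega⟩, by simp; omega⟩
    rw [hV.initial, hU.initial]
  · rw [NCAnnulus.hQuantity]
    split_ifs with hn
    · rw [← add_mul, ← map_mul, ← map_mul, ← map_add, hHe n hn, map_mul, mul_assoc,
        Ring.mul_inverse_cancel _ (hunit n), mul_one]
    · rw [mul_assoc, mul_assoc, ← mul_add, ← map_mul, ← map_mul, ← map_add,
        hHo n (Int.not_even_iff_odd.1 hn), map_mul, ← mul_assoc,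
        Ring.inverse_mul_cancel _ (hunit n), one_mul]
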